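/- Setting. Let $d\ge 1$, and give $\mathbb Z^d$ the componentwise order; $\bigvee$ and $\bigwedge$ are componentwise join and meet. Let $\Phi$ be a finite gain graph with gain group $\mathbb Z^d$: a finite graph with vertices $v_1,\dots,v_n$ (loops, parallel edges and half edges allowed) in which each loop or link $e$, oriented from $v_i$ to $v_j$, has a gain $\phi(e)\in\mathbb Z^d$, the opposite orientation having gain $-\phi(e)$. The gain of a path or circle is the sum of the gains of its edges (oriented along it). Assume that $\Phi$ has no loops of gain $0$ and no loose edges (edges without endpoints). For each $i$ let $H_i\subseteq\mathbb Z^d$ be a list of the form $\{x: x\ge a\}\setminus A$ with $a\in\mathbb Z^d$ and $A$ a finite subset of $\{x: x\ge a\}$. Put $h_i:=\bigwedge H_i$, $\bar H_i:=\{x: x\ge h_i\}\setminus H_i$ (a finite set), and $\hat h_i:=\bigvee\bar H_i$, or $\hat h_i:=h_i-(1,\dots,1)$ if $\bar H_i=\varnothing$. The list chromatic function $\chi(m)$, for $m=(m_1,\dots,m_n)\in(\mathbb Z^d)^n$, is the number of $x=(x_1,\dots,x_n)\in(\mathbb Z^d)^n$ with $x_i\in H_i$ and $x_i\le m_i$ for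 all $i$, and $x_j\ne x_i+\phi(e)$ for every loop or link $e$ from $v_i$ to $v_j$. An edge set $B$ is balanced if it has no half edges and all its circles have gain $0$; a balanced $B$ is closed if it contains every edge whose endpoints are joined by a path in $B$ with the same gain. Let $L$ be the poset of closed balanced edge sets, ordered by inclusion, with Möbius function $\mu$. Let $\pi(B)$ be the partition of the vertex set into the vertex sets of the components of $B$, and let $\eta_B$ be the top switching function of $B$: the function from the vertices to $\mathbb Z^d$ with $-\eta_B(v_i)+\phi(e)+\eta_B(v_j)=0$ for every edge $e$ of $B$ from $v_i$ to $v_j$ and $\bigwedge_{v\in W}\eta_B(v)=0$ for every $W\in\pi(B)$. For $B\in L$, $W\in\pi(B)$, $1\le k\le d$ and real variables $m_{ik}$ define $$q_k(B,W):=\min_{v_i\in W}\bigl(m_{ik}+\eta_B(v_i)_k\bigr)-\max_{v_i\in W}\bigl(h_{ik}+\eta_B(v_i)_k\bigr)+1,$$ $$S(B,W):=\Bigl\{c\in\bigcup_{v_i\in W}\bigl(\bar H_i+\eta_B(v_i)\bigr): c\ge\bigvee_{v_i\in W}\bigl(h_i+\eta_B(v_i)\bigr)\Bigr\},$$ $$p(m):=\sum_{B\in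 L}\mu(\varnothing,B)\prod_{W\in\pi(B)}\Bigl(\prod_{k=1}^d q_k(B,W)-\bigl|S(B,W)\bigr|\Bigr).$$ Let $\alpha_{ji}$ be the join of the gains of all paths from $v_j$ to $v_i$ (including the path of length $0$ if $i=j$), and let $b_i:=\bigvee_j(\hat h_j+\alpha_{ji})$, over those $j$ for which there is a path from $v_j$ to $v_i$. A function $f:\mathbb R^r\to\mathbb R$ is called a piecewise polynomial with leading term $y_1\cdots y_r$ if $\mathbb R^r$ is the union of finitely many closed full-dimensional sets $D_\sigma$ on each of which $f$ agrees with a polynomial $p_\sigma$, where at least one $p_\sigma$ is $y_1\cdots y_r$ plus terms of lower total degree, and every $p_\sigma$ has degree at most $1$ in each variable. Theorem. The number $\chi(m)$ is finite for every $m\in(\mathbb Z^d)^n$. The function $p$ is a piecewise polynomial in the $nd$ real variables $m_{ik}$ with leading term $\prod_{i=1}^n\prod_{k=1}^d m_{ik}$. The list chromatic function $\chi$ is the restriction to $(\mathbb Z^d)^n$ of a piecewise polynomial on $(\mathbb R^d)^n$ with the same leading term, which may be chosen equal to $p$ at all real points $m$ with $m_i\ge b_i$ for all $i$. In particular, $\chi(m)=p(m)$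 for all $m\in(\mathbb Z^d)^n$ with $m_i\ge b_i$ for all $i$. -/

import Mathlib

/-- The possible edges of a gain graph on the vertex set `V` with (additive) gain group `G`.
`arc u v g` is an ordinary edge (a link if `u ≠ v`, a loop if `u = v`), recorded through one of its
two orientations: its gain is `g` from `u` to `v` and `-g` from `v` to `u`.  A half edge has one
endpoint, a loose edge has none; neither carries a gain. -/
inductive GainEdge (V G : Type*) where
  | arc (u v : V) (g : G)
  | half (v : V)
  | loose

/-- A gain graph with vertex set `V`, edge set `E` and gain group `G`; parallel edges are allowed. -/
structure GainGraph (V E G : Type*) where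
  edge : E → GainEdge V G

namespace GainGraph

section General

variable {V E G : Type*} [AddCommGroup G] (Φ : GainGraph V E G)

/-- The edge `e`, oriented from `u` to `v`, has gain `g`. -/
def Step (e : E) (u v : V) (g : G) : Prop :=
  Φ.edge e = GainEdge.arc u v g ∨ Φ.edge e = GainEdge.arc v u (-g)

/-- `Φ.Walk S u l v g`: the list `l` of pairs (edge, vertex reached through it) is a walk from `u`
to `v` with edges in `S`, and its gain (the sum of the gains of its oriented edges) is `g`. -/
inductive Walk (S : Finset E) : V → List (E × V) → V → G → Prop
  | nil (u : V) : Walk S u [] u 0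
  | cons {e : E} {u v w : V} {g g' : G} {l : List (E × V)} (he : e ∈ S) (hs : Φ.Step e u v g)
      (hw : Walk S v l w g') : Walk S u ((e, v) :: l) w (g + g')

/-- There is an (open) path in `S` from `u` to `v` with gain `g`: a walk without repeated vertex.
The path of length `0` from `u` to `u` has gain `0`. -/
def PathGain (S : Finset E) (u v : V) (g : G) : Prop :=
  ∃ l : List (E × V), Φ.Walk S u l v g ∧ (u :: l.map Prod.snd).Nodup

/-- There is a circle in `S` which, started at `v` and traversed in one of its directions,
has gain `g`: a closed walk of positive length without repeated edge and without repeated vertex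
(other than the first being the last).  A loop is a circle of length `1`. -/
def CircleGain (S : Finset E) (v : V) (g : G) : Prop :=
  ∃ l : List (E × V), l ≠ [] ∧ Φ.Walk S v l v g ∧ (l.map Prod.fst).Nodup ∧ (l.map Prod.snd).Nodup

/-- An edge set is balanced if it has no half edges and all its circles have gain `0`. -/
def Balanced (S : Finset E) : Prop :=
  (∀ e ∈ S, ∀ v, Φ.edge e ≠ GainEdge.half v) ∧ ∀ v g, Φ.CircleGain S v g → g = 0

/-- A balanced edge set `S` is closed if it contains every edge whose endpoints are joined by a path
in `S` with the same gain (loose edges are treated like balanced loops). -/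
def Closed (S : Finset E) : Prop :=
  (∀ e, Φ.edge e = GainEdge.loose → e ∈ S) ∧
    ∀ e u v g, Φ.PathGain S u v g → Φ.Step e u v g → e ∈ S

/-- The semilattice of closed, balanced edge sets, ordered by inclusion. -/
abbrev Latb : Type _ := {B : Finset E // Φ.Balanced B ∧ Φ.Closed B}

open Classical in
/-- The value `μ(∅, B)` of the Möbius function of the poset of closed balanced edge sets;
it is `0` by convention if `∅` is not closed. -/
noncomputable def muEmpty [Fintype E] (B : Φ.Latb) : ℤ :=
  letI : LocallyFiniteOrder Φ.Latb := Fintype.toLocallyFiniteOrder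
  if h : Φ.Balanced ∅ ∧ Φ.Closed ∅ then IncidenceAlgebra.mu ℤ (⟨∅, h⟩ : Φ.Latb) B else 0

open Classical in
/-- The vertex set of the component of `(V, S)` that contains `u`. -/
noncomputable def component [Fintype V] (S : Finset E) (u : V) : Finset V :=
  Finset.univ.filter fun v => ∃ l g, Φ.Walk S u l v g

open Classical in
/-- The partition `π(S)` of `V` into the vertex sets of the components of `(V, S)`. -/
noncomputable def parts [Fintype V] (S : Finset E) : Finset (Finset V) :=
  Finset.univ.image (Φ.component S)

/-- `η` is a top switching function for `S`: the gains of the edges in `S`, switched by `η`,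
are `0`, and in each component of `S` the meet of the values of `η` is `0`. -/
def IsTopSwitching [Fintype V] [PartialOrder G] (S : Finset E) (η : V → G) : Prop :=
  (∀ e ∈ S, ∀ u v g, Φ.Step e u v g → -η u + g + η v = 0) ∧
    ∀ W ∈ Φ.parts S, IsGLB (η '' (W : Set V)) 0

/-- The top switching function `η_S` of a balanced edge set `S`
(an arbitrary function if `S` has no top switching function). -/
noncomputable def topSwitching [Fintype V] [PartialOrder G] (S : Finset E) : V → G :=
  Classical.epsilon (Φ.IsTopSwitching S)

end General

end GainGraph

section Lists

variable {d : ℕ}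

/-- The class `𝔚₂` of vertex lists: (cone) minus (finite set), where the cone with apex `a` is
`Set.Ici a = {x | a ≤ x}` for the componentwise order of `ℤ^d`. -/
def IsConeMinusFinite (H : Set (Fin d → ℤ)) : Prop :=
  ∃ (a : Fin d → ℤ) (A : Set (Fin d → ℤ)), A.Finite ∧ A ⊆ Set.Ici a ∧ H = Set.Ici a \ A

/-- The meet of the members of a list (the infimum is taken componentwise). -/
noncomputable def apex (H : Set (Fin d → ℤ)) : Fin d → ℤ := sInf H

/-- The cone complement of a list: the colors above its apex that do not belong to it. -/
def holes (H : Set (Fin d → ℤ)) : Set (Fin d → ℤ) := Set.Ici (apex H) \ H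

open Classical in
/-- The join of the holes of a list, or its apex minus `(1, …, 1)` if there are no holes. -/
noncomputable def holeTop (H : Set (Fin d → ℤ)) : Fin d → ℤ :=
  if holes H = ∅ then apex H - 1 else sSup (holes H)

end Lists

section Piecewise

variable {ι : Type*}

/-- The function `f` on `ℝ^ι` is the polynomial `P σ` on the set `D σ` for each of the finitely many
indices `σ`, where the `D σ` are closed, full-dimensional (non-empty, and each point is a limit of
interior points) and cover `ℝ^ι`. -/
def HasPieces {N : ℕ} (f : (ι → ℝ) → ℝ) (D : Fin N → Set (ι → ℝ))
    (P : Fin N → MvPolynomial ι ℝ) : Prop :=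
  (∀ σ, IsClosed (D σ) ∧ (D σ).Nonempty ∧ D σ ⊆ closure (interior (D σ))) ∧
    (⋃ σ, D σ) = Set.univ ∧ ∀ σ, ∀ y ∈ D σ, f y = MvPolynomial.eval y (P σ)

/-- The polynomial `P` has leading term `∏ i, y i`: all its other terms have smaller total degree. -/
def IsMonicMultilinear [Fintype ι] (P : MvPolynomial ι ℝ) : Prop :=
  ∀ s ∈ (P - ∏ i, MvPolynomial.X i).support, s.degree < Fintype.card ι

/-- `f` is a piecewise polynomial with leading term `∏ i, y i`: at least one of its polynomials has
that leading term, and all of them have degree at most `1` in each variable. -/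
def IsPiecewisePolynomialWithLeadingProd [Fintype ι] (f : (ι → ℝ) → ℝ) : Prop :=
  ∃ (N : ℕ) (D : Fin N → Set (ι → ℝ)) (P : Fin N → MvPolynomial ι ℝ), HasPieces f D P ∧
    (∃ σ, IsMonicMultilinear (P σ)) ∧ ∀ σ i, (P σ).degreeOf i ≤ 1

end Piecewise

namespace GainGraph

section Lattice

variable {V E : Type*} {d : ℕ} (Φ : GainGraph V E (Fin d → ℤ)) (H : V → Set (Fin d → ℤ))

/-- The proper colorations `x` with `x i` in the list `H i` and `x i ≤ m i` for all `i`. -/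
def properColorations (m : V → Fin d → ℤ) : Set (V → Fin d → ℤ) :=
  {x | (∀ i, x i ∈ H i ∧ x i ≤ m i) ∧ ∀ e i j g, Φ.Step e i j g → x j ≠ x i + g}

/-- The list chromatic function. -/
noncomputable def listChromatic (m : V → Fin d → ℤ) : ℕ := (Φ.properColorations H m).ncard

/-- The join `α_ji(Φ)` of the gains of all paths from `j` to `i` (used only if there is one). -/
noncomputable def alpha [Fintype E] (j i : V) : Fin d → ℤ :=
  sSup {g | Φ.PathGain Finset.univ j i g}

/-- The lower bound for `m i`: the join of `holeTop (H j) + alpha j i` over all `j` from which there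
is a path to `i` (an empty join `alpha j i` imposes no condition). -/
noncomputable def bound [Fintype E] (i : V) : Fin d → ℤ :=
  sSup {z | ∃ j, (∃ g, Φ.PathGain Finset.univ j i g) ∧ z = holeTop (H j) + Φ.alpha j i}

variable [Fintype V]

/-- The function `q_k(B, W)` of the real variables `y (i, k)`; the infimum and the supremum are
a minimum and a maximum over the non-empty finite set `W`. -/
noncomputable def q (B : Finset E) (W : Finset V) (k : Fin d) (y : V × Fin d → ℝ) : ℝ :=
  (⨅ i : W, (y (i, k) + (Φ.topSwitching B i k : ℝ))) -
    (⨆ i : W, ((apex (H i) k : ℝ) + (Φ.topSwitching B i k : ℝ))) + 1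

/-- The switched holes of the lists in `W` that lie in all the switched cones of the lists
in `W`. -/
def switchedHoles (B : Finset E) (W : Finset V) : Set (Fin d → ℤ) :=
  {c | (∃ i ∈ W, ∃ a ∈ holes (H i), c = a + Φ.topSwitching B i) ∧
    ∀ i ∈ W, apex (H i) + Φ.topSwitching B i ≤ c}

open Classical in
/-- The Möbius function sum `p`, as a function of the real variables `y (i, k)`. -/
noncomputable def p [Fintype E] (y : V × Fin d → ℝ) : ℝ :=
  ∑ B : Φ.Latb, (Φ.muEmpty B : ℝ) *
    ∏ W ∈ Φ.parts B.1, ((∏ k, Φ.q H B.1 W k y) - ((Φ.switchedHoles H B.1 W).ncard : ℝ))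

end Lattice

end GainGraph

/-! ### Walks, potentials and components -/

namespace GainGraph

section Walks

variable {V E G : Type*} [AddCommGroup G] {Φ : GainGraph V E G} {S : Finset E}

/-! The edges that a coloration x makes improper form a balanced closed set, because x itself serves
as a potential on them. Möbius inversion over `Latb` therefore writes χ(m) as the sum over B of μ(∅,
B) times the number of x that make all edges of B improper. After switching by η_B such an x is
constant on each component W of B, so this number is a product over W (`listChromatic_eq_sum`). The
admissible constants form an integral box minus the switched holes below its upper corner T.

Replace the side lengths of the box by max(q_k, 0), and the indicator of c ≤ T by the product over k
of T_k - c_k + 1 clamped to [0, 1]. The result, `realChromatic`, is continuous and exact at integral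
points. Above b all q_k are nonnegative and every hole is counted fully
(`holeTop_add_topSwitching_le`), so it equals p there.

At each point, p and `realChromatic` agree with one of finitely many polynomials, since a minimum or
maximum selects one of its arguments. The degree in each variable is at most 1, because different
factors of a product involve disjoint sets of variables. For a continuous function such a selection
already yields closed full-dimensional pieces: the sets of agreement are closed and cover the space,
so their interiors have dense union.

The leading term of p comes from B = ∅, whose components are single vertices; any other B has fewer
components and contributes lower degree. `realChromatic` inherits the leading term because it
coincides with p on a nonempty open set. -/

theorem Step.symm {e : E} {u v : V} {g : G} (h : Φ.Step e u v g) : Φ.Step e v u (-g) := by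
  rcases h with h | h
  · exact Or.inr (by simpa using h)
  · exact Or.inl h

theorem Step.gain_eq {e : E} {u v : V} {g g' : G} (h : Φ.Step e u v g) (h' : Φ.Step e u v g')
    (huv : u ≠ v) : g = g' := by
  rcases h with h | h <;> rcases h' with h' | h' <;> rw [h] at h' <;>
    simp only [GainEdge.arc.injEq, neg_inj] at h'
  · exact h'.2.2
  · exact absurd h'.1 huv
  · exact absurd h'.2.1 huv
  · exact h'.2.2

theorem Step.endpoints {e : E} {u v u' v' : V} {g g' : G} (h : Φ.Step e u v g)
    (h' : Φ.Step e u' v' g') : (u = u' ∧ v = v') ∨ (u = v' ∧ v = u') := by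
  rcases h with h | h <;> rcases h' with h' | h' <;> rw [h] at h' <;>
    simp only [GainEdge.arc.injEq] at h' <;> tauto

theorem walk_nil_iff {u v : V} {g : G} : Φ.Walk S u [] v g ↔ u = v ∧ g = 0 := by
  constructor
  · rintro ⟨⟩; exact ⟨rfl, rfl⟩
  · rintro ⟨rfl, rfl⟩; exact Walk.nil u

theorem walk_cons_iff {u w v : V} {e : E} {l : List (E × V)} {g : G} :
    Φ.Walk S u ((e, v) :: l) w g ↔
      ∃ g₁ g₂, e ∈ S ∧ Φ.Step e u v g₁ ∧ Φ.Walk S v l w g₂ ∧ g = g₁ + g₂ := by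
  constructor
  · intro h
    cases h with
    | cons he hs hw => exact ⟨_, _, he, hs, hw, rfl⟩
  · rintro ⟨g₁, g₂, he, hs, hw, rfl⟩
    exact Walk.cons he hs hw

theorem walk_append_iff {l l' : List (E × V)} {u w : V} {g : G} :
    Φ.Walk S u (l ++ l') w g ↔
      ∃ v g₁ g₂, Φ.Walk S u l v g₁ ∧ Φ.Walk S v l' w g₂ ∧ g = g₁ + g₂ := by
  induction l generalizing u g with
  | nil => simp [walk_nil_iff]
  | cons a l ih =>
    obtain ⟨e, x⟩ := a
    simp only [List.cons_append, walk_cons_iff, ih]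
    constructor
    · rintro ⟨g₁, g₂, he, hs, ⟨v, g₃, g₄, h₁, h₂, rfl⟩, rfl⟩
      exact ⟨v, g₁ + g₃, g₄, ⟨g₁, g₃, he, hs, h₁, rfl⟩, h₂, by abel⟩
    · rintro ⟨v, g₁, g₂, ⟨g₃, g₄, he, hs, h₁, rfl⟩, h₂, rfl⟩
      exact ⟨g₃, g₄ + g₂, he, hs, ⟨v, g₄, g₂, h₁, h₂, rfl⟩, by abel⟩

theorem Walk.append {l l' : List (E × V)} {u v w : V} {g g' : G} (h : Φ.Walk S u l v g)
    (h' : Φ.Walk S v l' w g') : Φ.Walk S u (l ++ l') w (g + g') :=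
  walk_append_iff.2 ⟨_, _, _, h, h', rfl⟩

theorem Walk.reverse {l : List (E × V)} {u v : V} {g : G} (h : Φ.Walk S u l v g) :
    ∃ l', Φ.Walk S v l' u (-g) := by
  induction h with
  | nil u => exact ⟨[], by simpa using Walk.nil u⟩
  | @cons e u v w g g' l he hs hw ih =>
    obtain ⟨l', hl'⟩ := ih
    refine ⟨l' ++ [(e, u)], ?_⟩
    rw [neg_add_rev]
    refine hl'.append ?_
    simpa using Walk.cons he hs.symm (Walk.nil u)

theorem Walk.mono {T : Finset E} (hST : S ⊆ T) {l : List (E × V)} {u v : V} {g : G}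
    (h : Φ.Walk S u l v g) : Φ.Walk T u l v g := by
  induction h with
  | nil u => exact Walk.nil u
  | cons he hs _ ih => exact Walk.cons (hST he) hs ih

/-- The last vertex of a nonempty walk is one of the vertices reached. -/
theorem Walk.end_mem {l : List (E × V)} {u v : V} {g : G} (h : Φ.Walk S u l v g) (hl : l ≠ []) :
    v ∈ l.map Prod.snd := by
  induction h with
  | nil u => exact absurd rfl hl
  | @cons e u v w g g' l he hs hw ih =>
    by_cases hl' : l = []
    · subst hl'
      obtain ⟨rfl, -⟩ := walk_nil_iff.1 hw
      simp
    · simp only [List.map_cons, List.mem_cons]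
      exact Or.inr (ih hl')

/-- Used to cut a closed walk at a repeated edge or vertex. -/
theorem exists_append_of_not_nodup_map {α β : Type*} (f : α → β) {l : List α}
    (h : ¬ (l.map f).Nodup) :
    ∃ l₁ a l₂ b l₃, l = l₁ ++ a :: (l₂ ++ b :: l₃) ∧ f a = f b := by
  induction l with
  | nil => simp at h
  | cons a l ih =>
    by_cases ha : f a ∈ l.map f
    · obtain ⟨b, hb, hab⟩ := List.mem_map.1 ha
      obtain ⟨s, t, rfl⟩ := List.append_of_mem hb
      exact ⟨[], a, s, b, t, rfl, hab.symm⟩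
    · have : ¬ (l.map f).Nodup := fun hn => h (by simpa using ⟨by simpa using ha, hn⟩)
      obtain ⟨l₁, x, l₂, y, l₃, rfl, hxy⟩ := ih this
      exact ⟨a :: l₁, x, l₂, y, l₃, rfl, hxy⟩

/-- In a balanced edge set, every closed walk has gain `0`. -/
theorem Balanced.closed_walk (hS : Φ.Balanced S) {l : List (E × V)} {v : V} {g : G}
    (h : Φ.Walk S v l v g) : g = 0 := by
  induction hn : l.length using Nat.strong_induction_on generalizing l v g with
  | _ n ih =>
  subst hn
  by_cases hl : l = []
  · subst hl; exact (walk_nil_iff.1 h).2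
  by_cases hv : (l.map Prod.snd).Nodup
  · by_cases he : (l.map Prod.fst).Nodup
    · exact hS.2 v g ⟨l, hl, h, he, hv⟩
    · obtain ⟨l₁, ⟨e, w₁⟩, l₂, ⟨e', w₂⟩, l₃, rfl, rfl : e = e'⟩ :=
        exists_append_of_not_nodup_map _ he
      obtain ⟨u₁, g₁, _, h₁, k₁, rfl⟩ := walk_append_iff.1 h
      obtain ⟨g₂, _, heS, hs, k₂, rfl⟩ := walk_cons_iff.1 k₁
      obtain ⟨u₂, g₃, _, h₂, k₃, rfl⟩ := walk_append_iff.1 k₂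
      obtain ⟨g₄, g₅, -, hs', h₃, rfl⟩ := walk_cons_iff.1 k₃
      have hw : w₁ ≠ w₂ := by
        rintro rfl
        simp [List.nodup_append] at hv
      obtain ⟨-, h⟩ | ⟨rfl, rfl⟩ := hs.endpoints hs'
      · exact absurd h hw
      -- The edge is now traversed in opposite directions. A nonempty `l₂` would reach `w₁` a second
      -- time, so this is an immediate backtrack; its two gains cancel and it can be deleted.
      have hl₂ : l₂ = [] := by
        by_contra hne
        have := h₂.end_mem hne
        simp only [List.map_append, List.map_cons, List.nodup_append, List.nodup_cons,
          List.mem_append] at hv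
        exact hv.2.1.1 (Or.inl this)
      subst hl₂
      obtain ⟨-, rfl⟩ := walk_nil_iff.1 h₂
      have hg : g₄ = -g₂ := hs'.gain_eq hs.symm hw
      have := ih _ (by simp only [List.length_append, List.length_cons]; omega)
        (h₁.append h₃) rfl
      calc g₁ + (g₂ + (0 + (g₄ + g₅))) = g₁ + g₅ := by rw [hg]; abel
        _ = 0 := this
  -- A repeated vertex `w` splits the walk into two shorter closed walks: the detour from `w` to
  -- `w`, and what remains without it.
  · obtain ⟨l₁, ⟨e, w⟩, l₂, ⟨e', w'⟩, l₃, rfl, rfl : w = w'⟩ :=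
      exists_append_of_not_nodup_map _ hv
    obtain ⟨u₁, g₁, _, h₁, k₁, rfl⟩ := walk_append_iff.1 h
    obtain ⟨g₂, _, heS, hs, k₂, rfl⟩ := walk_cons_iff.1 k₁
    obtain ⟨u₂, g₃, _, h₂, k₃, rfl⟩ := walk_append_iff.1 k₂
    obtain ⟨g₄, g₅, heS', hs', h₃, rfl⟩ := walk_cons_iff.1 k₃
    have e₁ := ih _ (by simp only [List.length_append, List.length_cons]; omega)
      (h₁.append (Walk.cons heS hs h₃)) rfl
    have e₂ := ih _ (by simp only [List.length_append, List.length_cons, List.length_nil]; omega)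
      (h₂.append (Walk.cons heS' hs' (Walk.nil w))) rfl
    calc g₁ + (g₂ + (g₃ + (g₄ + g₅))) = (g₁ + (g₂ + g₅)) + (g₃ + (g₄ + 0)) := by abel
      _ = 0 := by rw [e₁, e₂, add_zero]

/-- If the new start vertex already lies on the path, everything before it is dropped. The gain may
change; in a balanced set it is recovered from the potential. -/
theorem Walk.exists_path {l : List (E × V)} {u v : V} {g : G} (h : Φ.Walk S u l v g) :
    ∃ g', Φ.PathGain S u v g' := by
  induction h with
  | nil u => exact ⟨0, [], Walk.nil u, by simp⟩
  | @cons e u v w g g' l he hs hw ih =>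
    obtain ⟨g₁, l₁, h₁, hn⟩ := ih
    by_cases hu : u ∈ v :: l₁.map Prod.snd
    · rcases List.mem_cons.1 hu with rfl | hu
      · exact ⟨g₁, l₁, h₁, hn⟩
      · obtain ⟨⟨e', x⟩, hb, rfl⟩ := List.mem_map.1 hu
        obtain ⟨s, t, rfl⟩ := List.append_of_mem hb
        obtain ⟨x', g₂, _, h₂, h', rfl⟩ := walk_append_iff.1 h₁
        obtain ⟨g₃, g₄, -, hs, h₃, rfl⟩ := walk_cons_iff.1 h'
        refine ⟨g₄, t, h₃, hn.sublist ?_⟩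
        simp
    · exact ⟨g + g₁, (e, v) :: l₁, Walk.cons he hs h₁, List.nodup_cons.2 ⟨hu, hn⟩⟩

theorem Walk.gain_eq_sub {η : V → G}
    (hη : ∀ e ∈ S, ∀ u v g, Φ.Step e u v g → -η u + g + η v = 0) {l : List (E × V)} {u v : V}
    {g : G} (h : Φ.Walk S u l v g) : g = η u - η v := by
  induction h with
  | nil u => simp
  | @cons e u v w g g' l he hs hw ih =>
    have := hη e he _ _ _ hs
    rw [ih]
    have : g = η u - η v := by
      rw [← sub_eq_zero, ← this]; abel
    rw [this]; abel

/-- A function that is compatible with every edge of a walk adds up its gain. -/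
theorem Walk.eq_add {x : V → G} (hx : ∀ e ∈ S, ∀ u v g, Φ.Step e u v g → x v = x u + g)
    {l : List (E × V)} {u v : V} {g : G} (h : Φ.Walk S u l v g) : x v = x u + g := by
  induction h with
  | nil u => simp
  | cons he hs _ ih => rw [ih, hx _ he _ _ _ hs]; abel

section Components

variable [Fintype V]

theorem mem_component {u v : V} : v ∈ Φ.component S u ↔ ∃ l g, Φ.Walk S u l v g := by
  simp [component]

theorem self_mem_component (u : V) : u ∈ Φ.component S u :=
  mem_component.2 ⟨[], 0, Walk.nil u⟩

theorem component_eq_of_mem {u v : V} (h : v ∈ Φ.component S u) :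
    Φ.component S v = Φ.component S u := by
  obtain ⟨l, g, h⟩ := mem_component.1 h
  obtain ⟨l', h'⟩ := h.reverse
  ext w
  rw [mem_component, mem_component]
  constructor
  · rintro ⟨l₁, g₁, h₁⟩; exact ⟨_, _, h.append h₁⟩
  · rintro ⟨l₁, g₁, h₁⟩; exact ⟨_, _, h'.append h₁⟩

theorem component_mem_parts (u : V) : Φ.component S u ∈ Φ.parts S := by
  classical
  exact Finset.mem_image_of_mem _ (Finset.mem_univ u)

theorem eq_component {W : Finset V} (hW : W ∈ Φ.parts S) {u : V} (hu : u ∈ W) :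
    W = Φ.component S u := by
  classical
  obtain ⟨w, -, rfl⟩ := Finset.mem_image.1 hW
  exact (component_eq_of_mem hu).symm

theorem nonempty_of_mem_parts {W : Finset V} (hW : W ∈ Φ.parts S) : W.Nonempty := by
  classical
  obtain ⟨w, -, rfl⟩ := Finset.mem_image.1 hW
  exact ⟨w, self_mem_component w⟩

theorem exists_walk_of_mem_parts {W : Finset V} (hW : W ∈ Φ.parts S) {u v : V} (hu : u ∈ W)
    (hv : v ∈ W) : ∃ l g, Φ.Walk S u l v g := by
  rw [eq_component hW hu] at hv
  exact mem_component.1 hv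

/-- A balanced edge set has a potential. -/
theorem Balanced.exists_potential (hS : Φ.Balanced S) :
    ∃ η : V → G, ∀ e ∈ S, ∀ u v g, Φ.Step e u v g → -η u + g + η v = 0 := by
  -- The potential of `u` is the gain of a walk from `u` to a base vertex of its component; balance
  -- makes it independent of the walk.
  choose r hr using fun W : {W // W ∈ Φ.parts S} => nonempty_of_mem_parts W.2
  have hw : ∀ u, ∃ g l, Φ.Walk S u l (r ⟨_, component_mem_parts u⟩) g := fun u => by
    obtain ⟨l, g, h⟩ := mem_component.1 (hr ⟨_, component_mem_parts u⟩)
    exact ⟨g, l, h⟩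
  choose η l hη using hw
  refine ⟨η, fun e he u v g hs => ?_⟩
  have hc : Φ.component S v = Φ.component S u :=
    component_eq_of_mem (mem_component.2 ⟨[(e, v)], g + 0, Walk.cons he hs (Walk.nil v)⟩)
  obtain ⟨l', h'⟩ := (hη u).reverse
  have hv := hη v
  simp only [hc] at hv
  rw [← hS.closed_walk (h'.append (Walk.cons he hs hv)), add_assoc]

theorem Balanced.isTopSwitching {d : ℕ} {Φ : GainGraph V E (Fin d → ℤ)} (hS : Φ.Balanced S) :
    Φ.IsTopSwitching S (Φ.topSwitching S) := by
  refine Classical.epsilon_spec (p := Φ.IsTopSwitching S) ?_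
  obtain ⟨η, hη⟩ := hS.exists_potential
  have hne : ∀ u, (Φ.component S u).Nonempty := fun u => ⟨u, self_mem_component u⟩
  -- Subtracting the coordinatewise minimum over each component makes the meet 0 and leaves
  -- differences within components unchanged.
  refine ⟨fun u k => η u k - (Φ.component S u).inf' (hne u) (fun v => η v k), ?_, ?_⟩
  · intro e he u v g hs
    have hc : Φ.component S v = Φ.component S u :=
      component_eq_of_mem (mem_component.2 ⟨[(e, v)], g + 0, Walk.cons he hs (Walk.nil v)⟩)
    have := hη e he u v g hs
    funext k
    have := congrFun this k
    simp only [Pi.add_apply, Pi.neg_apply, Pi.zero_apply, hc] at this ⊢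
    linarith
  · intro W hW
    constructor
    · rintro _ ⟨u, hu, rfl⟩ k
      simp only [Pi.zero_apply, sub_nonneg]
      exact Finset.inf'_le _ (self_mem_component u)
    · intro b hb k
      obtain ⟨u, hu⟩ := nonempty_of_mem_parts hW
      have hWu := eq_component hW hu
      obtain ⟨v, hv, hvk⟩ := Finset.exists_mem_eq_inf' (hne u) (fun v => η v k)
      have := hb (Set.mem_image_of_mem _ (show v ∈ (W : Set V) by rw [hWu]; exact hv)) k
      simp only [component_eq_of_mem hv, hvk, sub_self] at this
      exact this

theorem Balanced.gain_eq {d : ℕ} {Φ : GainGraph V E (Fin d → ℤ)} (hS : Φ.Balanced S)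
    {l : List (E × V)} {u v : V} {g : Fin d → ℤ} (h : Φ.Walk S u l v g) :
    g = Φ.topSwitching S u - Φ.topSwitching S v :=
  h.gain_eq_sub hS.isTopSwitching.1

end Components

end Walks

end GainGraph

/-! ### Lists: cones with finitely many holes -/

section ConeLists

variable {d : ℕ} {H : Set (Fin d → ℤ)}

theorem IsConeMinusFinite.nonempty (hd : 0 < d) (hH : IsConeMinusFinite H) : H.Nonempty := by
  obtain ⟨a, A, hA, -, rfl⟩ := hH
  -- For d = 0 the cone is a single point, and the list could be empty.
  have : Nonempty (Fin d) := ⟨⟨0, hd⟩⟩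
  exact ((Set.Ici_infinite a).sdiff hA).nonempty

theorem IsConeMinusFinite.bddBelow (hH : IsConeMinusFinite H) : BddBelow H := by
  obtain ⟨a, A, -, -, rfl⟩ := hH
  exact ⟨a, fun x hx => hx.1⟩

theorem IsConeMinusFinite.apex_le (hH : IsConeMinusFinite H) {x : Fin d → ℤ} (hx : x ∈ H) :
    apex H ≤ x :=
  csInf_le hH.bddBelow hx

theorem IsConeMinusFinite.finite_holes (hd : 0 < d) (hH : IsConeMinusFinite H) :
    (holes H).Finite := by
  have hne := hH.nonempty hd
  obtain ⟨a, A, hA, -, hHA⟩ := hH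
  have ha : a ≤ apex H := le_csInf hne fun x hx => by rw [hHA] at hx; exact hx.1
  refine hA.subset fun x hx => ?_
  by_contra hxA
  exact hx.2 (by rw [hHA]; exact ⟨ha.trans hx.1, hxA⟩)

theorem IsConeMinusFinite.mem_iff (hH : IsConeMinusFinite H) {x : Fin d → ℤ} :
    x ∈ H ↔ apex H ≤ x ∧ x ∉ holes H := by
  constructor
  · exact fun hx => ⟨hH.apex_le hx, fun h => h.2 hx⟩
  · rintro ⟨h₁, h₂⟩
    by_contra h
    exact h₂ ⟨h₁, h⟩

theorem IsConeMinusFinite.le_holeTop (hd : 0 < d) (hH : IsConeMinusFinite H) {x : Fin d → ℤ}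
    (hx : x ∈ holes H) : x ≤ holeTop H := by
  rw [holeTop, if_neg (Set.nonempty_iff_ne_empty.1 ⟨x, hx⟩)]
  exact le_csSup (hH.finite_holes hd).bddAbove hx

theorem IsConeMinusFinite.apex_sub_one_le_holeTop (hd : 0 < d) (hH : IsConeMinusFinite H) :
    apex H - 1 ≤ holeTop H := by
  by_cases h : holes H = ∅
  · rw [holeTop, if_pos h]
  · obtain ⟨x, hx⟩ := Set.nonempty_iff_ne_empty.2 h
    have h₁ : apex H ≤ x := hx.1
    refine le_trans ?_ (h₁.trans (hH.le_holeTop hd hx))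
    intro k
    simp

end ConeLists

/-! ### Finiteness of path gains and the bound -/

namespace GainGraph

section Bounds

variable {V E G : Type*} [AddCommGroup G] {Φ : GainGraph V E G} {S : Finset E}

theorem finite_step [Finite E] : {g | ∃ e u v, Φ.Step e u v g}.Finite := by
  have : {g | ∃ e u v, Φ.Step e u v g} ⊆
      ⋃ e, {g | ∃ u v, Φ.edge e = GainEdge.arc u v g ∨ Φ.edge e = GainEdge.arc u v (-g)} := by
    rintro g ⟨e, u, v, h | h⟩
    · exact Set.mem_iUnion.2 ⟨e, u, v, Or.inl h⟩
    · exact Set.mem_iUnion.2 ⟨e, v, u, Or.inr h⟩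
  refine (Set.finite_iUnion fun e => ?_).subset this
  cases he : Φ.edge e with
  | arc u v g =>
    refine (Set.toFinite {g, -g}).subset ?_
    rintro g' ⟨u', v', h | h⟩ <;> simp only [GainEdge.arc.injEq] at h
    · exact Or.inl h.2.2.symm
    · exact Or.inr (by rw [h.2.2, neg_neg]; rfl)
  | half v => simp
  | loose => simp

theorem finite_walk_gain [Finite E] (n : ℕ) :
    {g | ∃ u l v, Φ.Walk S u l v g ∧ l.length = n}.Finite := by
  induction n with
  | zero =>
    refine (Set.finite_singleton (0 : G)).subset ?_
    rintro g ⟨u, l, v, h, hl⟩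
    rw [List.length_eq_zero_iff] at hl
    subst hl
    exact (walk_nil_iff.1 h).2
  | succ n ih =>
    refine (Set.Finite.image2 (· + ·) (finite_step (Φ := Φ)) ih).subset ?_
    rintro g ⟨u, l, v, h, hl⟩
    cases h with
    | nil => simp at hl
    | cons he hs hw => exact ⟨_, ⟨_, _, _, hs⟩, _, ⟨_, _, _, hw, by simpa using hl⟩, rfl⟩

/-- A path has fewer edges than there are vertices, and each step has finitely many possible gains.
Hence the `sSup` in `alpha` is a genuine join wherever a path exists. -/
theorem finite_pathGain [Finite E] [Fintype V] (u v : V) : {g | Φ.PathGain S u v g}.Finite := by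
  refine (Set.Finite.biUnion (Set.finite_le_nat (Fintype.card V))
    fun n _ => finite_walk_gain (Φ := Φ) (S := S) n).subset ?_
  rintro g ⟨l, h, hn⟩
  refine Set.mem_biUnion (x := l.length) ?_ ⟨u, l, v, h, rfl⟩
  have := hn.length_le_card
  simp only [List.length_cons, List.length_map] at this
  show l.length ≤ _
  omega

theorem le_bound [Fintype V] [Fintype E] {d : ℕ} {Φ : GainGraph V E (Fin d → ℤ)}
    (H : V → Set (Fin d → ℤ)) {i j : V} {g : Fin d → ℤ} (h : Φ.PathGain Finset.univ j i g) :
    holeTop (H j) + g ≤ Φ.bound H i := by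
  have h₁ : g ≤ Φ.alpha j i := le_csSup (finite_pathGain j i).bddAbove h
  refine (add_le_add_right h₁ _).trans (le_csSup (Set.Finite.bddAbove ?_) ⟨j, ⟨g, h⟩, rfl⟩)
  refine (Set.finite_range fun j => holeTop (H j) + Φ.alpha j i).subset ?_
  rintro _ ⟨j, -, rfl⟩
  exact ⟨j, rfl⟩

/-- A path in B from j to i has gain η_B(j) - η_B(i), and this gain is below α_ji. So above the
bound every switched hole of W lies below every switched upper bound of W. -/
theorem holeTop_add_topSwitching_le [Fintype V] [Fintype E] {d : ℕ}
    {Φ : GainGraph V E (Fin d → ℤ)} (H : V → Set (Fin d → ℤ)) {B : Finset E} (hB : Φ.Balanced B)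
    {W : Finset V} (hW : W ∈ Φ.parts B) {i j : V} (hi : i ∈ W) (hj : j ∈ W) :
    holeTop (H j) + Φ.topSwitching B j ≤ Φ.bound H i + Φ.topSwitching B i := by
  obtain ⟨l, g, h⟩ := exists_walk_of_mem_parts hW hj hi
  obtain ⟨g', l', h', hn⟩ := h.exists_path
  have := le_bound H ⟨l', h'.mono (Finset.subset_univ B), hn⟩
  rw [hB.gain_eq h'] at this
  intro k
  have := this k
  simp only [Pi.add_apply, Pi.sub_apply] at this ⊢
  linarith

end Bounds

end GainGraph

/-! ### Continuous selections of polynomials are piecewise polynomial -/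

section FiniteSelection

open MvPolynomial

variable {ι : Type*}

/-- At each point, `f` agrees with one of finitely many polynomials that satisfy `Q`. -/
def FiniteSelection (Q : MvPolynomial ι ℝ → Prop) (f : (ι → ℝ) → ℝ) : Prop :=
  ∃ 𝓕 : Set (MvPolynomial ι ℝ), 𝓕.Finite ∧ (∀ P ∈ 𝓕, Q P) ∧ ∀ y, ∃ P ∈ 𝓕, f y = eval y P

namespace FiniteSelection

variable {Q Q' : MvPolynomial ι ℝ → Prop} {f g : (ι → ℝ) → ℝ}

theorem of_poly {P : MvPolynomial ι ℝ} (hP : Q P) (hf : ∀ y, f y = eval y P) :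
    FiniteSelection Q f :=
  ⟨{P}, Set.finite_singleton P, by simpa using hP, fun y => ⟨P, rfl, hf y⟩⟩

theorem mono (h : FiniteSelection Q f) (hQ : ∀ P, Q P → Q' P) : FiniteSelection Q' f := by
  obtain ⟨𝓕, h₁, h₂, h₃⟩ := h
  exact ⟨𝓕, h₁, fun P hP => hQ P (h₂ P hP), h₃⟩

theorem of_cases {κ : Type*} [Finite κ] {F : κ → (ι → ℝ) → ℝ} (hF : ∀ a, FiniteSelection Q (F a))
    (h : ∀ y, ∃ a, f y = F a y) : FiniteSelection Q f := by
  choose 𝓕 h₁ h₂ h₃ using hF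
  refine ⟨⋃ a, 𝓕 a, Set.finite_iUnion h₁, ?_, fun y => ?_⟩
  · intro P hP
    obtain ⟨a, ha⟩ := Set.mem_iUnion.1 hP
    exact h₂ a P ha
  · obtain ⟨a, ha⟩ := h y
    obtain ⟨P, hP, hy⟩ := h₃ a y
    exact ⟨P, Set.mem_iUnion.2 ⟨a, hP⟩, ha.trans hy⟩

/-- Finitely many selections can be combined by any operation on polynomials that commutes with
evaluation; all tuples of selected polynomials are allowed, so the family stays finite. -/
theorem map {κ : Type*} [Finite κ] {R : κ → MvPolynomial ι ℝ → Prop} {F : κ → (ι → ℝ) → ℝ}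
    (hF : ∀ a, FiniteSelection (R a) (F a)) (T : (κ → MvPolynomial ι ℝ) → MvPolynomial ι ℝ)
    (hT : ∀ p, (∀ a, R a (p a)) → Q (T p))
    (hf : ∀ y p, (∀ a, F a y = eval y (p a)) → f y = eval y (T p)) : FiniteSelection Q f := by
  choose 𝓕 h₁ h₂ h₃ using hF
  refine ⟨T '' Set.univ.pi 𝓕, (Set.Finite.pi h₁).image T, ?_, fun y => ?_⟩
  · rintro _ ⟨p, hp, rfl⟩
    exact hT p fun a => h₂ a _ (hp a trivial)
  · choose p hp hy using fun a => h₃ a y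
    exact ⟨T p, ⟨p, fun a _ => hp a, rfl⟩, hf y p hy⟩

theorem map₂ {R R' : MvPolynomial ι ℝ → Prop} (hf : FiniteSelection R f)
    (hg : FiniteSelection R' g) {h : (ι → ℝ) → ℝ}
    (T : MvPolynomial ι ℝ → MvPolynomial ι ℝ → MvPolynomial ι ℝ)
    (hT : ∀ p q, R p → R' q → Q (T p q))
    (hh : ∀ y p q, f y = eval y p → g y = eval y q → h y = eval y (T p q)) :
    FiniteSelection Q h :=
  map (κ := Bool) (R := fun b => cond b R R') (F := fun b => cond b f g)
    (Bool.rec hg hf) (fun p => T (p true) (p false)) (fun _ hp => hT _ _ (hp true) (hp false))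
    fun y _ hp => hh y _ _ (hp true) (hp false)

end FiniteSelection

/-- The pieces are the closures of the interiors of the sets where `f` agrees with a polynomial.
Polynomials agreeing with `f` on no open set are dropped. The function `g` supplies a piece with the
right leading term. -/
theorem isPiecewisePolynomialWithLeadingProd_of_finiteSelection [Fintype ι]
    {f : (ι → ℝ) → ℝ} (hf : Continuous f)
    (h : FiniteSelection (fun P => ∀ i, P.degreeOf i ≤ 1) f)
    {g : (ι → ℝ) → ℝ}
    (hg : FiniteSelection (fun P => IsMonicMultilinear P ∧ ∀ i, P.degreeOf i ≤ 1) g)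
    {U : Set (ι → ℝ)} (hU : IsOpen U) (hne : U.Nonempty) (hfg : ∀ y ∈ U, f y = g y) :
    IsPiecewisePolynomialWithLeadingProd f := by
  obtain ⟨𝓕, hfin, hdeg, hsel⟩ := h
  obtain ⟨𝓖, hfin', hdeg', hsel'⟩ := hg
  set A : MvPolynomial ι ℝ → Set (ι → ℝ) := fun P => {y | f y = eval y P} with hA
  have hAc : ∀ P, IsClosed (A P) := fun P => isClosed_eq hf P.continuous_eval
  set T : Set (MvPolynomial ι ℝ) := {P | P ∈ 𝓕 ∪ 𝓖 ∧ (interior (A P)).Nonempty} with hT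
  have hTfin : T.Finite := (hfin.union hfin').subset fun P hP => hP.1
  have : Finite T := hTfin
  have hTdeg : ∀ P ∈ T, ∀ i, P.degreeOf i ≤ 1 := by
    rintro P ⟨hP | hP, -⟩
    · exact hdeg P hP
    · exact (hdeg' P hP).2
  obtain ⟨N, ⟨e⟩⟩ := Finite.exists_equiv_fin T
  refine ⟨N, fun σ => closure (interior (A (e.symm σ))), fun σ => (e.symm σ).1,
    ⟨fun σ => ⟨isClosed_closure, (e.symm σ).2.2.closure, ?_⟩, ?_, fun σ y hy => ?_⟩, ?_,
    fun σ i => hTdeg _ (e.symm σ).2 i⟩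
  · exact closure_mono (interior_maximal subset_closure isOpen_interior)
  · have : Finite 𝓕 := hfin
    have hd := dense_iUnion_interior_of_closed (f := fun P : 𝓕 => A P) (fun P => hAc P) (by
      rw [Set.eq_univ_iff_forall]
      intro y
      obtain ⟨P, hP, hy⟩ := hsel y
      exact Set.mem_iUnion.2 ⟨⟨P, hP⟩, hy⟩)
    -- By finiteness the closure of the union of the interiors is the union of the pieces, so the
    -- pieces cover everything.
    rw [dense_iff_closure_eq, closure_iUnion_of_finite] at hd
    rw [Set.eq_univ_iff_forall] at hd ⊢
    intro y
    obtain ⟨P, hP⟩ := Set.mem_iUnion.1 (hd y)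
    have hPT : P.1 ∈ T := ⟨Or.inl P.2, closure_nonempty_iff.1 ⟨y, hP⟩⟩
    refine Set.mem_iUnion.2 ⟨e ⟨P, hPT⟩, ?_⟩
    simpa using hP
  · exact closure_minimal interior_subset (hAc _) hy
  · have : Finite 𝓖 := hfin'
    -- The complement of `U` completes the agreement sets of `𝓖` to a closed cover; density then
    -- gives a point of `U` interior to one of these agreement sets.
    have hd := dense_iUnion_interior_of_closed
      (f := fun P : Option 𝓖 => P.elim Uᶜ fun P => A P)
      (fun P => by
        cases P with
        | none => exact hU.isClosed_compl
        | some P => exact hAc P) (by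
      rw [Set.eq_univ_iff_forall]
      intro y
      by_cases hy : y ∈ U
      · obtain ⟨P, hP, hyP⟩ := hsel' y
        exact Set.mem_iUnion.2 ⟨some ⟨P, hP⟩, (hfg y hy).trans hyP⟩
      · exact Set.mem_iUnion.2 ⟨none, hy⟩)
    obtain ⟨y, hyU, hy⟩ := hd.inter_open_nonempty U hU hne
    obtain ⟨P, hP⟩ := Set.mem_iUnion.1 hy
    cases P with
    | none => exact absurd hyU (interior_subset hP)
    | some P =>
      refine ⟨e ⟨P, Or.inr P.2, y, hP⟩, ?_⟩
      simpa using (hdeg' P P.2).1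

end FiniteSelection

/-! ### Leading forms and total degree -/

section LeadingForm

open MvPolynomial

variable {ι : Type*}

/-- All monomials of `P` have total degree less than `n`. -/
def DegreeLT (n : ℕ) (P : MvPolynomial ι ℝ) : Prop := ∀ s ∈ P.support, s.degree < n

namespace DegreeLT

variable {n m : ℕ} {P Q : MvPolynomial ι ℝ}

theorem mono (h : DegreeLT n P) (hnm : n ≤ m) : DegreeLT m P :=
  fun s hs => (h s hs).trans_le hnm

protected theorem zero : DegreeLT n (0 : MvPolynomial ι ℝ) := fun s hs => by simp at hs

protected theorem C (c : ℝ) : DegreeLT 1 (C c : MvPolynomial ι ℝ) := by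
  intro s hs
  rw [C_apply] at hs
  have := support_monomial_subset hs
  rw [Finset.mem_singleton] at this
  simp [this]

protected theorem X (i : ι) : DegreeLT 2 (X i : MvPolynomial ι ℝ) := by
  intro s hs
  rw [support_X, Finset.mem_singleton] at hs
  simp [hs]

protected theorem add (hP : DegreeLT n P) (hQ : DegreeLT n Q) : DegreeLT n (P + Q) := by
  classical
  intro s hs
  rcases Finset.mem_union.1 (support_add hs) with h | h
  · exact hP s h
  · exact hQ s h

/-- Both bounds are strict, hence the shift by one: degree at most n times degree below m has degree
below n + m. -/
protected theorem mul (hP : DegreeLT (n + 1) P) (hQ : DegreeLT m Q) :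
    DegreeLT (n + m) (P * Q) := by
  classical
  intro s hs
  obtain ⟨a, ha, b, hb, rfl⟩ := Finset.mem_add.1 (support_mul _ _ hs)
  have h₁ := hP a ha
  have h₂ := hQ b hb
  rw [map_add]
  omega

protected theorem C_mul (c : ℝ) (hP : DegreeLT n P) : DegreeLT n (C c * P) := by
  simpa using (DegreeLT.C c).mul (n := 0) hP

protected theorem sum {κ : Type*} {s : Finset κ} {F : κ → MvPolynomial ι ℝ}
    (h : ∀ a ∈ s, DegreeLT n (F a)) : DegreeLT n (∑ a ∈ s, F a) := by
  classical
  induction s using Finset.induction_on with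
  | empty => simpa using DegreeLT.zero
  | insert a s ha ih =>
    rw [Finset.sum_insert ha]
    exact (h a (Finset.mem_insert_self a s)).add
      (ih fun b hb => h b (Finset.mem_insert_of_mem hb))

end DegreeLT

/-- `P` is `M`, of total degree at most `n`, plus terms of total degree less than `n`. -/
def HasLeadingForm (M : MvPolynomial ι ℝ) (n : ℕ) (P : MvPolynomial ι ℝ) : Prop :=
  DegreeLT (n + 1) M ∧ DegreeLT n (P - M)

namespace HasLeadingForm

variable {n n' : ℕ} {M M' P P' : MvPolynomial ι ℝ}

theorem degreeLT (h : HasLeadingForm M n P) : DegreeLT (n + 1) P := by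
  simpa using h.1.add (h.2.mono n.le_succ)

theorem add (h : HasLeadingForm M n P) (h' : DegreeLT n P') : HasLeadingForm M n (P + P') :=
  ⟨h.1, by simpa [add_sub_right_comm] using h.2.add h'⟩

theorem X_add_C (i : ι) (c : ℝ) : HasLeadingForm (X i) 1 (X i + C c) :=
  ⟨DegreeLT.X i, by simpa using DegreeLT.C c⟩

theorem mul (h : HasLeadingForm M n P) (h' : HasLeadingForm M' n' P') :
    HasLeadingForm (M * M') (n + n') (P * P') := by
  refine ⟨h.1.mul h'.1, ?_⟩
  have : P * P' - M * M' = P * (P' - M') + M' * (P - M) := by ring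
  rw [this]
  refine (h.degreeLT.mul h'.2).add ?_
  rw [add_comm n]
  exact h'.1.mul h.2

theorem prod {κ : Type*} {s : Finset κ} {F G : κ → MvPolynomial ι ℝ} {m : κ → ℕ}
    (h : ∀ a ∈ s, HasLeadingForm (F a) (m a) (G a)) :
    HasLeadingForm (∏ a ∈ s, F a) (∑ a ∈ s, m a) (∏ a ∈ s, G a) := by
  classical
  induction s using Finset.induction_on with
  | empty =>
    refine ⟨?_, ?_⟩
    · simpa using DegreeLT.C (ι := ι) 1
    · simpa using DegreeLT.zero
  | insert a s ha ih =>
    rw [Finset.sum_insert ha, Finset.prod_insert ha, Finset.prod_insert ha]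
    exact (h a (Finset.mem_insert_self a s)).mul
      (ih fun b hb => h b (Finset.mem_insert_of_mem hb))

end HasLeadingForm

end LeadingForm

/-! ### Möbius inversion over sets of improper edges -/

namespace GainGraph

section MoebiusCount

variable {V E G : Type*} [AddCommGroup G] {Φ : GainGraph V E G}

open Classical in
/-- The edges that `x` makes improper. -/
noncomputable def improperEdges [Fintype E] (Φ : GainGraph V E G) (x : V → G) : Finset E :=
  Finset.univ.filter fun e => ∃ u v g, Φ.Step e u v g ∧ x v = x u + g

theorem Step.eq_add_of_eq_add {e : E} {u v u' v' : V} {g g' : G} {x : V → G}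
    (h : Φ.Step e u v g) (h' : Φ.Step e u' v' g') (hx : x v = x u + g) : x v' = x u' + g' := by
  rcases h with h | h <;> rcases h' with h' | h' <;> rw [h] at h' <;>
    simp only [GainEdge.arc.injEq] at h' <;> obtain ⟨rfl, rfl, hg⟩ := h'
  · rw [← hg, hx]
  · rw [hx, hg]; abel
  · rw [hx, ← hg]; abel
  · rw [hx, neg_inj.1 hg]

theorem mem_improperEdges_iff [Fintype E] {x : V → G} {e : E} {u v : V} {g : G}
    (hs : Φ.Step e u v g) : e ∈ Φ.improperEdges x ↔ x v = x u + g := by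
  simp only [improperEdges, Finset.mem_filter, Finset.mem_univ, true_and]
  exact ⟨fun ⟨_, _, _, h, hx⟩ => h.eq_add_of_eq_add hs hx, fun h => ⟨u, v, g, hs, h⟩⟩

theorem improperEdges_eq_empty_iff [Fintype E] {x : V → G} :
    Φ.improperEdges x = ∅ ↔ ∀ e u v g, Φ.Step e u v g → x v ≠ x u + g := by
  simp [improperEdges, Finset.filter_eq_empty_iff]

theorem Walk.eq_add_of_improperEdges [Fintype E] {x : V → G} {l : List (E × V)} {u v : V} {g : G}
    (h : Φ.Walk (Φ.improperEdges x) u l v g) : x v = x u + g :=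
  h.eq_add fun _ he _ _ _ hs => (mem_improperEdges_iff hs).1 he

theorem improperEdges_balanced [Fintype E] (x : V → G) : Φ.Balanced (Φ.improperEdges x) := by
  classical
  constructor
  · intro e he v hv
    rw [improperEdges, Finset.mem_filter] at he
    obtain ⟨-, u, v, g, h | h, -⟩ := he <;> rw [hv] at h <;> cases h
  · rintro v g ⟨l, -, h, -, -⟩
    simpa using h.eq_add_of_improperEdges

theorem improperEdges_closed [Fintype E] (hloose : ∀ e, Φ.edge e ≠ GainEdge.loose) (x : V → G) :
    Φ.Closed (Φ.improperEdges x) :=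
  ⟨fun e he => absurd he (hloose e), fun _ _ _ _ ⟨_, h, _⟩ hs =>
    (mem_improperEdges_iff hs).2 h.eq_add_of_improperEdges⟩

/-- A balanced loop or a loose edge would belong to every closed set; without them ∅ is the bottom
of `Latb`. -/
theorem empty_mem_latb (hloop : ∀ e v, ¬ Φ.Step e v v 0)
    (hloose : ∀ e, Φ.edge e ≠ GainEdge.loose) : Φ.Balanced ∅ ∧ Φ.Closed ∅ := by
  have hw : ∀ {l : List (E × V)} {u v g}, Φ.Walk ∅ u l v g → u = v ∧ g = 0 := by
    intro l u v g h
    cases h with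
    | nil => exact ⟨rfl, rfl⟩
    | cons he => simp at he
  refine ⟨⟨by simp, fun v g ⟨_, _, h, _⟩ => (hw h).2⟩, fun e he => absurd he (hloose e), ?_⟩
  rintro e u v g ⟨l, h, -⟩ hs
  obtain ⟨rfl, rfl⟩ := hw h
  exact absurd hs (hloop e u)

open Classical in
-- The B contained in I form the interval [∅, I], over which μ(∅, ·) sums to the Kronecker delta.
theorem sum_muEmpty [Fintype E] (hloop : ∀ e v, ¬ Φ.Step e v v 0)
    (hloose : ∀ e, Φ.edge e ≠ GainEdge.loose) (I : Φ.Latb) :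
    ∑ B : Φ.Latb, (if B.1 ⊆ I.1 then Φ.muEmpty B else 0) = if I.1 = ∅ then 1 else 0 := by
  let _ : LocallyFiniteOrder Φ.Latb := Fintype.toLocallyFiniteOrder
  have h₀ := empty_mem_latb hloop hloose
  have key := IncidenceAlgebra.sum_Icc_mu_right (𝕜 := ℤ) (⟨∅, h₀⟩ : Φ.Latb) I
  have h₁ : ((⟨∅, h₀⟩ : Φ.Latb) = I) ↔ I.1 = ∅ := by
    rw [Subtype.ext_iff]; exact eq_comm
  simp only [h₁] at key
  rw [← key, ← Finset.sum_filter]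
  refine Finset.sum_congr ?_ fun B _ => ?_
  · ext B
    simp only [Finset.mem_filter, Finset.mem_univ, true_and, Finset.mem_Icc]
    exact ⟨fun h => ⟨Finset.empty_subset _, h⟩, fun h => h.2⟩
  · rw [muEmpty, dif_pos h₀]

theorem muEmpty_empty [Fintype E] (h : Φ.Balanced ∅ ∧ Φ.Closed ∅) :
    Φ.muEmpty ⟨∅, h⟩ = 1 := by
  rw [muEmpty, dif_pos h]
  simp

open Classical in
/-- The number of members of `X` without improper edges, by Möbius inversion. -/
theorem card_proper_eq_sum [Fintype E] (hloop : ∀ e v, ¬ Φ.Step e v v 0)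
    (hloose : ∀ e, Φ.edge e ≠ GainEdge.loose) (X : Finset (V → G)) :
    ((X.filter fun x => Φ.improperEdges x = ∅).card : ℤ) =
      ∑ B : Φ.Latb, Φ.muEmpty B * ((X.filter fun x => B.1 ⊆ Φ.improperEdges x).card : ℤ) := by
  simp only [Finset.card_filter, Nat.cast_sum, Nat.cast_ite, Nat.cast_one, Nat.cast_zero,
    Finset.mul_sum]
  rw [Finset.sum_comm]
  refine Finset.sum_congr rfl fun x _ => ?_
  rw [← sum_muEmpty hloop hloose
    ⟨Φ.improperEdges x, improperEdges_balanced x, improperEdges_closed hloose x⟩]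
  refine Finset.sum_congr rfl fun B _ => ?_
  simp

variable [Fintype V] {S : Finset E}

/-- Along a walk of improper edges in S, both x and -η increase by the gain, so x + η stays
constant. -/
theorem Balanced.subset_improperEdges_iff [Fintype E] (hloose : ∀ e, Φ.edge e ≠ GainEdge.loose)
    (hS : Φ.Balanced S) {η : V → G}
    (hη : ∀ e ∈ S, ∀ u v g, Φ.Step e u v g → -η u + g + η v = 0) {x : V → G} :
    S ⊆ Φ.improperEdges x ↔ ∀ u, ∀ v ∈ Φ.component S u, x v + η v = x u + η u := by
  constructor
  · intro h u v hv
    obtain ⟨l, g, hw⟩ := mem_component.1 hv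
    rw [(hw.mono h).eq_add_of_improperEdges, hw.gain_eq_sub hη]
    abel
  · intro h e he
    obtain ⟨u, v, g, hs⟩ : ∃ u v g, Φ.Step e u v g := by
      cases hedge : Φ.edge e with
      | arc u v g => exact ⟨u, v, g, Or.inl hedge⟩
      | half v => exact absurd hedge (hS.1 e he v)
      | loose => exact absurd hedge (hloose e)
    rw [mem_improperEdges_iff hs]
    have h₁ := h u v (mem_component.2 ⟨[(e, v)], g + 0, Walk.cons he hs (Walk.nil v)⟩)
    have h₂ := hη e he u v g hs
    have h₃ : g = η u - η v := by
      rw [← sub_eq_zero, ← h₂]; abel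
    rw [h₃, eq_sub_of_add_eq h₁]; abel

/-- The functions that are constant on components after switching, with values in given sets,
correspond to one admissible color for each component. -/
theorem card_switched_constant (η : V → G) (Y : V → Set G) :
    Nat.card {x : V → G // (∀ i, x i ∈ Y i) ∧
        ∀ u, ∀ v ∈ Φ.component S u, x v + η v = x u + η u} =
      ∏ W ∈ Φ.parts S, Nat.card {c : G // ∀ i ∈ W, c - η i ∈ Y i} := by
  classical
  rw [← Finset.prod_coe_sort, ← Nat.card_pi]
  choose r hr using fun W : Φ.parts S => nonempty_of_mem_parts W.2
  refine Nat.card_congr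
    { toFun := fun x W => ⟨x.1 (r W) + η (r W), fun i hi => ?_⟩
      invFun := fun c => ⟨fun i => (c ⟨_, component_mem_parts i⟩).1 - η i, fun i => ?_, ?_⟩
      left_inv := fun x => ?_
      right_inv := fun c => ?_ }
  · have h : i ∈ Φ.component S (r W) := by rwa [← eq_component W.2 (hr W)]
    rw [← x.2.2 _ i h]
    simpa using x.2.1 i
  · exact (c ⟨_, component_mem_parts i⟩).2 i (self_mem_component i)
  · intro u v hv
    simp only [sub_add_cancel]
    exact congrArg (fun W => (c W).1) (Subtype.ext (component_eq_of_mem hv))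
  · ext i
    simp only
    rw [x.2.2 i _ (hr ⟨_, component_mem_parts i⟩), add_sub_cancel_right]
  · funext W
    apply Subtype.ext
    simp only [sub_add_cancel]
    exact congrArg (fun W => (c W).1) (Subtype.ext (eq_component W.2 (hr W)).symm)

end MoebiusCount

/-! ### The list chromatic function as a Möbius sum -/

section ListCount

variable {V E : Type*} [Fintype V] [Fintype E] {d : ℕ} {Φ : GainGraph V E (Fin d → ℤ)}
  {H : V → Set (Fin d → ℤ)}

/-- The admissible colors of a component `W`, switched by `η`, for the upper bound `m`. -/
def admissibleColors (H : V → Set (Fin d → ℤ)) (η m : V → Fin d → ℤ) (W : Finset V) :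
    Set (Fin d → ℤ) :=
  {c | ∀ i ∈ W, c - η i ∈ H i ∧ c - η i ≤ m i}

theorem finite_list_le (hH : ∀ i, IsConeMinusFinite (H i)) (m : V → Fin d → ℤ) :
    {x : V → Fin d → ℤ | ∀ i, x i ∈ H i ∧ x i ≤ m i}.Finite := by
  classical
  exact (Set.finite_Icc (fun i => apex (H i)) m).subset fun _ hx =>
    ⟨fun i => (hH i).apex_le (hx i).1, fun i => (hx i).2⟩

theorem listChromatic_eq_sum (hloop : ∀ e v, ¬ Φ.Step e v v 0)
    (hloose : ∀ e, Φ.edge e ≠ GainEdge.loose) (hH : ∀ i, IsConeMinusFinite (H i))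
    (m : V → Fin d → ℤ) [Fintype Φ.Latb] :
    (Φ.listChromatic H m : ℝ) = ∑ B : Φ.Latb, (Φ.muEmpty B : ℝ) *
      ∏ W ∈ Φ.parts B.1, ((admissibleColors H (Φ.topSwitching B.1) m W).ncard : ℝ) := by
  classical
  have hfin := finite_list_le hH m
  set X := hfin.toFinset with hX
  have h₁ : Φ.properColorations H m =
      ((X.filter fun x => Φ.improperEdges x = ∅ : Finset _) : Set (V → Fin d → ℤ)) := by
    ext x
    simp [properColorations, hX, improperEdges_eq_empty_iff]
  have h₂ := card_proper_eq_sum hloop hloose X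
  rw [listChromatic, h₁, Set.ncard_coe_finset, ← Int.cast_natCast, h₂, Int.cast_sum]
  refine Finset.sum_congr (by ext; simp) fun B _ => ?_
  rw [Int.cast_mul, Int.cast_natCast, ← Nat.cast_prod]
  congr 2
  have hη := B.2.1.isTopSwitching.1
  have h₃ := card_switched_constant (Φ := Φ) (S := B.1) (Φ.topSwitching B.1)
    (fun i => {c | c ∈ H i ∧ c ≤ m i})
  rw [← Set.ncard_coe_finset]
  refine Eq.trans ?_ h₃
  rw [← Nat.card_coe_set_eq]
  congr 2
  ext x
  simp only [hX, Finset.coe_filter, Set.Finite.mem_toFinset, Set.mem_ofPred_eq]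
  rw [B.2.1.subset_improperEdges_iff hloose hη]
  exact Iff.rfl

end ListCount

end GainGraph

/-! ### The continuous extension and its agreement with `p` -/

namespace GainGraph

section Truncated

variable {V E : Type*} [Fintype V] {d : ℕ} (Φ : GainGraph V E (Fin d → ℤ))
  (H : V → Set (Fin d → ℤ))

/-- The `k`-th coordinate of the meet of the switched upper bounds in `W`. -/
noncomputable def minUpper (B : Finset E) (W : Finset V) (k : Fin d) (y : V × Fin d → ℝ) : ℝ :=
  ⨅ i : W, (y (i, k) + (Φ.topSwitching B i k : ℝ))

/-- The `k`-th coordinate of the join of the switched apices in `W`. -/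
noncomputable def maxApex (B : Finset E) (W : Finset V) (k : Fin d) : ℝ :=
  ⨆ i : W, ((apex (H i) k : ℝ) + (Φ.topSwitching B i k : ℝ))

/-- A continuous function that counts the admissible colors of `W` at integral upper bounds. -/
noncomputable def truncatedCount (B : Finset E) (W : Finset V) (y : V × Fin d → ℝ) : ℝ :=
  ∏ k, max (Φ.q H B W k y) 0 -
    ∑ᶠ c ∈ Φ.switchedHoles H B W, ∏ k, max 0 (min 1 (Φ.minUpper B W k y - (c k : ℝ) + 1))

open Classical in
/-- A continuous extension of the list chromatic function to real arguments. -/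
noncomputable def realChromatic [Fintype E] (y : V × Fin d → ℝ) : ℝ :=
  ∑ B : Φ.Latb, (Φ.muEmpty B : ℝ) * ∏ W ∈ Φ.parts B.1, Φ.truncatedCount H B.1 W y

variable {Φ H} {B : Finset E} {W : Finset V}

theorem q_eq (k : Fin d) (y : V × Fin d → ℝ) :
    Φ.q H B W k y = Φ.minUpper B W k y + (1 - Φ.maxApex H B W k) := by
  simp only [q, minUpper, maxApex]; ring

theorem finite_switchedHoles (hd : 0 < d) (hH : ∀ i, IsConeMinusFinite (H i)) :
    (Φ.switchedHoles H B W).Finite := by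
  refine (Set.finite_iUnion fun i => ((hH i).finite_holes hd).image
    (· + Φ.topSwitching B i)).subset ?_
  rintro c ⟨⟨i, -, a, ha, rfl⟩, -⟩
  exact Set.mem_iUnion.2 ⟨i, a, ha, rfl⟩

theorem minUpper_intCast (hW : W.Nonempty) (k : Fin d) (m : V → Fin d → ℤ) :
    Φ.minUpper B W k (fun ik => (m ik.1 ik.2 : ℝ)) =
      ((⨅ i : W, (m i k + Φ.topSwitching B i k) : ℤ) : ℝ) := by
  have : Nonempty W := hW.to_subtype
  obtain ⟨i, hi⟩ := exists_eq_ciInf_of_finite (f := fun i : W => m i k + Φ.topSwitching B i k)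
  refine le_antisymm ?_ (le_ciInf fun j => ?_)
  · rw [← hi]
    refine (ciInf_le (Set.finite_range _).bddBelow i).trans ?_
    push_cast; exact le_rfl
  · simp only
    exact_mod_cast ciInf_le (Set.finite_range fun i : W => m i k + Φ.topSwitching B i k).bddBelow j

theorem maxApex_eq_intCast (hW : W.Nonempty) (k : Fin d) :
    Φ.maxApex H B W k = ((⨆ i : W, (apex (H i) k + Φ.topSwitching B i k) : ℤ) : ℝ) := by
  have : Nonempty W := hW.to_subtype
  obtain ⟨i, hi⟩ := exists_eq_ciSup_of_finite
    (f := fun i : W => apex (H i) k + Φ.topSwitching B i k)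
  refine le_antisymm (ciSup_le fun j => ?_) ?_
  · exact_mod_cast
      le_ciSup (Set.finite_range fun i : W => apex (H i) k + Φ.topSwitching B i k).bddAbove j
  · rw [← hi]
    refine le_trans ?_ (le_ciSup (Set.finite_range _).bddAbove i)
    push_cast; exact le_rfl

/-- With T the meet of the switched upper bounds and A the join of the switched apices, the
admissible colors are the box [A, T] without the switched holes. These already satisfy A ≤ c, so
only c ≤ T has to be tested. -/
theorem ncard_admissibleColors (hd : 0 < d) (hH : ∀ i, IsConeMinusFinite (H i))
    (hW : W.Nonempty) (m : V → Fin d → ℤ) :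
    ((admissibleColors H (Φ.topSwitching B) m W).ncard : ℝ) =
      Φ.truncatedCount H B W (fun ik => (m ik.1 ik.2 : ℝ)) := by
  classical
  have : Nonempty W := hW.to_subtype
  set T : Fin d → ℤ := fun k => ⨅ i : W, (m i k + Φ.topSwitching B i k) with hT
  set A : Fin d → ℤ := fun k => ⨆ i : W, (apex (H i) k + Φ.topSwitching B i k) with hA
  have hleT : ∀ c : Fin d → ℤ, c ≤ T ↔ ∀ i ∈ W, c - Φ.topSwitching B i ≤ m i := by
    intro c
    simp only [Pi.le_def, hT, le_ciInf_iff (Set.finite_range _).bddBelow, Subtype.forall,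
      sub_le_iff_le_add]
    exact ⟨fun h i hi k => h k i hi, fun h k i hi => h i hi k⟩
  have hAle : ∀ c : Fin d → ℤ, A ≤ c ↔ ∀ i ∈ W, apex (H i) + Φ.topSwitching B i ≤ c := by
    intro c
    simp only [Pi.le_def, hA, ciSup_le_iff (Set.finite_range _).bddAbove, Subtype.forall,
      Pi.add_apply]
    exact ⟨fun h i hi k => h k i hi, fun h k i hi => h i hi k⟩
  have hS := finite_switchedHoles (Φ := Φ) (B := B) (W := W) hd hH
  have hadm : admissibleColors H (Φ.topSwitching B) m W =
      (((Finset.Icc A T).filter fun c => ¬ c ∈ Φ.switchedHoles H B W : Finset _) :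
        Set (Fin d → ℤ)) := by
    ext c
    simp only [admissibleColors, Set.mem_ofPred_eq, Finset.coe_filter, Finset.mem_Icc]
    rw [hleT]
    constructor
    · intro h
      have hAc : ∀ i ∈ W, apex (H i) + Φ.topSwitching B i ≤ c := fun i hi =>
        le_sub_iff_add_le.1 ((hH i).apex_le (h i hi).1)
      refine ⟨⟨(hAle c).2 hAc, fun i hi => (h i hi).2⟩, ?_⟩
      rintro ⟨⟨i, hi, a, ha, rfl⟩, -⟩
      have := (h i hi).1
      rw [add_sub_cancel_right] at this
      exact ha.2 this
    · rintro ⟨⟨h₁, h₂⟩, h₃⟩ i hi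
      rw [hAle] at h₁
      refine ⟨(hH i).mem_iff.2 ⟨le_sub_iff_add_le.2 (h₁ i hi), fun ha => h₃ ?_⟩, h₂ i hi⟩
      exact ⟨⟨i, hi, _, ha, (sub_add_cancel _ _).symm⟩, h₁⟩
  have hholes : (Finset.Icc A T).filter (fun c => c ∈ Φ.switchedHoles H B W) =
      hS.toFinset.filter (fun c => c ≤ T) := by
    ext c
    simp only [Finset.mem_filter, Finset.mem_Icc, Set.Finite.mem_toFinset]
    exact ⟨fun h => ⟨h.2, h.1.2⟩, fun h => ⟨⟨(hAle c).2 h.1.2, h.2⟩, h.1⟩⟩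
  have hcard := Finset.card_filter_add_card_filter_not (s := Finset.Icc A T)
    (fun c => c ∈ Φ.switchedHoles H B W)
  rw [hholes] at hcard
  rw [hadm, Set.ncard_coe_finset]
  have hbox : ((Finset.Icc A T).card : ℝ) =
      ∏ k, max (Φ.q H B W k (fun ik => (m ik.1 ik.2 : ℝ))) 0 := by
    rw [Pi.card_Icc, Nat.cast_prod]
    refine Finset.prod_congr rfl fun k _ => ?_
    rw [Int.card_Icc, q_eq, minUpper_intCast hW, maxApex_eq_intCast hW, ← Int.cast_natCast,
      Int.toNat_eq_max]
    push_cast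
    congr 1
    ring
  have hsum : ((hS.toFinset.filter (fun c => c ≤ T)).card : ℝ) =
      ∑ᶠ c ∈ Φ.switchedHoles H B W, ∏ k,
        max 0 (min 1 (Φ.minUpper B W k (fun ik => (m ik.1 ik.2 : ℝ)) - (c k : ℝ) + 1)) := by
    rw [finsum_mem_eq_finite_toFinset_sum _ hS, Finset.card_filter, Nat.cast_sum]
    refine Finset.sum_congr rfl fun c _ => ?_
    simp only [minUpper_intCast hW]
    split_ifs with hc
    · rw [Nat.cast_one, eq_comm]
      refine Finset.prod_eq_one fun k _ => ?_
      have : (c k : ℝ) ≤ (T k : ℝ) := by exact_mod_cast hc k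
      rw [min_eq_left (by linarith), max_eq_right zero_le_one]
    · rw [Nat.cast_zero, eq_comm]
      simp only [Pi.le_def, not_forall, not_le] at hc
      obtain ⟨k, hk⟩ := hc
      refine Finset.prod_eq_zero (Finset.mem_univ k) ?_
      -- By integrality a failing coordinate fails by at least 1, which is where the clamped ramp
      -- reaches 0.
      have : (T k : ℝ) + 1 ≤ (c k : ℝ) := by exact_mod_cast hk
      exact max_eq_left ((min_le_right _ _).trans (by linarith))
  rw [truncatedCount, ← hbox, ← hsum, ← hcard]
  push_cast
  ring

theorem listChromatic_eq_realChromatic [Fintype E] (hd : 0 < d)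
    (hloop : ∀ e v, ¬ Φ.Step e v v 0) (hloose : ∀ e, Φ.edge e ≠ GainEdge.loose)
    (hH : ∀ i, IsConeMinusFinite (H i)) (m : V → Fin d → ℤ) :
    (Φ.listChromatic H m : ℝ) = Φ.realChromatic H (fun ik => (m ik.1 ik.2 : ℝ)) := by
  classical
  rw [listChromatic_eq_sum hloop hloose hH, realChromatic]
  refine Finset.sum_congr (by ext; simp) fun B _ => ?_
  congr 1
  exact Finset.prod_congr rfl fun W hW =>
    ncard_admissibleColors hd hH (nonempty_of_mem_parts hW) m

theorem truncatedCount_eq_of_bound_le [Fintype E] (hd : 0 < d)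
    (hH : ∀ i, IsConeMinusFinite (H i)) (hB : Φ.Balanced B) (hW : W ∈ Φ.parts B)
    {y : V × Fin d → ℝ} (hy : ∀ i k, (Φ.bound H i k : ℝ) ≤ y (i, k)) :
    Φ.truncatedCount H B W y =
      (∏ k, Φ.q H B W k y) - ((Φ.switchedHoles H B W).ncard : ℝ) := by
  have : Nonempty W := (nonempty_of_mem_parts hW).to_subtype
  have hS := finite_switchedHoles (Φ := Φ) (B := B) (W := W) hd hH
  have key : ∀ j ∈ W, ∀ k, (holeTop (H j) k : ℝ) + Φ.topSwitching B j k ≤ Φ.minUpper B W k y := by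
    refine fun j hj k => le_ciInf fun i => ?_
    have h₁ : holeTop (H j) k + Φ.topSwitching B j k ≤ Φ.bound H i k + Φ.topSwitching B i k :=
      holeTop_add_topSwitching_le H hB hW i.2 hj k
    have h₂ : (holeTop (H j) k : ℝ) + Φ.topSwitching B j k ≤
      Φ.bound H i k + Φ.topSwitching B i k := by exact_mod_cast h₁
    exact h₂.trans (add_le_add_left (hy i k) _)
  rw [truncatedCount]
  congr 1
  · refine Finset.prod_congr rfl fun k _ => max_eq_left ?_
    -- The + 1 in q_k allows the upper corner to fall one below the lower one; this matches the
    -- value apex - 1 of `holeTop` for a list without holes.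
    have : Φ.maxApex H B W k ≤ Φ.minUpper B W k y + 1 := by
      refine ciSup_le fun j => ?_
      have h₁ : (apex (H j) k : ℝ) - 1 ≤ holeTop (H j) k := by
        exact_mod_cast (hH j).apex_sub_one_le_holeTop hd k
      linarith [key j j.2 k]
    rw [q_eq]
    linarith
  · rw [finsum_mem_eq_finite_toFinset_sum _ hS, Set.ncard_eq_toFinset_card _ hS,
      Finset.card_eq_sum_ones, Nat.cast_sum]
    refine Finset.sum_congr rfl fun c hc => ?_
    rw [Nat.cast_one]
    refine Finset.prod_eq_one fun k _ => ?_
    obtain ⟨⟨j, hj, a, ha, rfl⟩, -⟩ := (hS.mem_toFinset).1 hc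
    have h₁ : (a k : ℝ) ≤ holeTop (H j) k := by exact_mod_cast (hH j).le_holeTop hd ha k
    have h₂ := key j hj k
    rw [Pi.add_apply, Int.cast_add, min_eq_left (by linarith), max_eq_right zero_le_one]

theorem realChromatic_eq_p [Fintype E] (hd : 0 < d) (hH : ∀ i, IsConeMinusFinite (H i))
    {y : V × Fin d → ℝ} (hy : ∀ i k, (Φ.bound H i k : ℝ) ≤ y (i, k)) :
    Φ.realChromatic H y = Φ.p H y := by
  rw [realChromatic, p]
  refine Finset.sum_congr rfl fun B _ => ?_
  congr 1
  exact Finset.prod_congr rfl fun W hW => truncatedCount_eq_of_bound_le hd hH B.2.1 hW hy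

theorem continuous_minUpper (hW : W.Nonempty) (k : Fin d) : Continuous (Φ.minUpper B W k) := by
  have : Nonempty W := hW.to_subtype
  have : Φ.minUpper B W k = fun y => Finset.univ.inf' Finset.univ_nonempty
      fun i : W => y (i, k) + (Φ.topSwitching B i k : ℝ) := by
    funext y
    rw [Finset.inf'_univ_eq_ciInf, minUpper]
  rw [this]
  exact Continuous.finset_inf'_apply _ fun i _ => by fun_prop

theorem continuous_q (hW : W.Nonempty) (k : Fin d) : Continuous (Φ.q H B W k) := by
  have : Φ.q H B W k = fun y => Φ.minUpper B W k y + (1 - Φ.maxApex H B W k) := funext (q_eq k)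
  rw [this]
  exact (continuous_minUpper hW k).add continuous_const

theorem continuous_truncatedCount (hd : 0 < d) (hH : ∀ i, IsConeMinusFinite (H i))
    (hW : W.Nonempty) : Continuous (Φ.truncatedCount H B W) := by
  have hS := finite_switchedHoles (Φ := Φ) (B := B) (W := W) hd hH
  unfold truncatedCount
  simp only [finsum_mem_eq_finite_toFinset_sum _ hS]
  refine (continuous_finsetProd _ fun k _ => (continuous_q hW k).max continuous_const).sub
    (continuous_finsetSum _ fun c _ => continuous_finsetProd _ fun k _ => ?_)
  exact continuous_const.max (continuous_const.min
    (((continuous_minUpper hW k).sub continuous_const).add continuous_const))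

theorem continuous_realChromatic [Fintype E] (hd : 0 < d) (hH : ∀ i, IsConeMinusFinite (H i)) :
    Continuous (Φ.realChromatic H) :=
  continuous_finsetSum _ fun _ _ => continuous_const.mul
    (continuous_finsetProd _ fun _ hW => continuous_truncatedCount hd hH (nonempty_of_mem_parts hW))

theorem continuous_p [Fintype E] : Continuous (Φ.p H) :=
  continuous_finsetSum _ fun _ _ => continuous_const.mul
    (continuous_finsetProd _ fun _ hW =>
      (continuous_finsetProd _ fun k _ => continuous_q (nonempty_of_mem_parts hW) k).sub
        continuous_const)

end Truncated

end GainGraph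

/-! ### Polynomial selections, degrees and leading terms -/

namespace GainGraph

section Selections

open MvPolynomial

section DegreeBounds

variable {V : Type*} {d : ℕ} {W : Finset V}

open Classical in
theorem degreeOf_X_add_C_le {i j : V} (hi : i ∈ W) (k k' : Fin d) (c : ℝ) :
    degreeOf (j, k') (X (i, k) + C c : MvPolynomial (V × Fin d) ℝ) ≤
      if j ∈ W ∧ k' = k then 1 else 0 := by
  refine (degreeOf_add_le _ _ _).trans (max_le ?_ (by simp))
  rw [degreeOf_X]
  split_ifs with h₁ h₂ h₂
  · exact le_rfl
  · simp only [Prod.mk.injEq] at h₁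
    exact absurd ⟨h₁.1 ▸ hi, h₁.2⟩ h₂
  · exact zero_le_one
  · exact le_rfl

open Classical in
theorem degreeOf_prod_coordinates_le {p : Fin d → MvPolynomial (V × Fin d) ℝ}
    (h : ∀ k j k', degreeOf (j, k') (p k) ≤ if j ∈ W ∧ k' = k then 1 else 0) (j : V)
    (k' : Fin d) : degreeOf (j, k') (∏ k, p k) ≤ if j ∈ W then 1 else 0 := by
  refine (degreeOf_prod_le _ _ _).trans ((Finset.sum_le_sum fun k _ => h k j k').trans ?_)
  by_cases hj : j ∈ W <;> simp [hj]

end DegreeBounds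

variable {V E : Type*} [Fintype V] {d : ℕ} {Φ : GainGraph V E (Fin d → ℤ)}
  {H : V → Set (Fin d → ℤ)} {B : Finset E} {W : Finset V}

theorem finiteSelection_minUpper_add (hW : W.Nonempty) (k : Fin d) (c : ℝ) :
    FiniteSelection (fun P => ∃ i ∈ W, ∃ c', P = X (i, k) + C c')
      (fun y => Φ.minUpper B W k y + c) := by
  have : Nonempty W := hW.to_subtype
  refine FiniteSelection.of_cases
    (F := fun (i : W) y => y (i, k) + ((Φ.topSwitching B i k : ℝ) + c)) (fun i => ?_) fun y => ?_
  · exact .of_poly (P := X (i.1, k) + C ((Φ.topSwitching B i k : ℝ) + c)) ⟨i, i.2, _, rfl⟩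
      fun y => by simp
  · obtain ⟨i, hi⟩ := exists_eq_ciInf_of_finite
      (f := fun i : W => y (i, k) + (Φ.topSwitching B i k : ℝ))
    exact ⟨i, by rw [minUpper, ← hi, add_assoc]⟩

theorem finiteSelection_q (hW : W.Nonempty) (k : Fin d) :
    FiniteSelection (fun P => ∃ i ∈ W, ∃ c', P = X (i, k) + C c') (Φ.q H B W k) := by
  have : Φ.q H B W k = fun y => Φ.minUpper B W k y + (1 - Φ.maxApex H B W k) := funext (q_eq k)
  rw [this]
  exact finiteSelection_minUpper_add hW k _

/-- The components are disjoint, so each variable occurs in at most one factor. -/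
theorem degreeOf_prod_parts_le {p : Φ.parts B → MvPolynomial (V × Fin d) ℝ}
    (h : ∀ W j k, degreeOf (j, k) (p W) ≤ open Classical in if j ∈ W.1 then 1 else 0)
    (i : V × Fin d) : degreeOf i (∏ W, p W) ≤ 1 := by
  classical
  refine (degreeOf_prod_le _ _ _).trans ((Finset.sum_le_sum fun W _ => h W i.1 i.2).trans ?_)
  rw [← Finset.card_filter, Finset.card_le_one]
  intro W hW W' hW'
  rw [Finset.mem_filter] at hW hW'
  exact Subtype.ext ((eq_component W.2 hW.2).trans (eq_component W'.2 hW'.2).symm)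

open Classical in
-- Each truncation selects a constant or a linear polynomial in one variable, and the factor for k
-- uses only variables (i, k) with i in W. Summing over holes does not raise degrees.
theorem finiteSelection_truncatedCount (hd : 0 < d) (hH : ∀ i, IsConeMinusFinite (H i))
    (hW : W.Nonempty) :
    FiniteSelection (fun P => ∀ j k, degreeOf (j, k) P ≤ if j ∈ W then 1 else 0)
      (Φ.truncatedCount H B W) := by
  have hS := finite_switchedHoles (Φ := Φ) (B := B) (W := W) hd hH
  have hlin : ∀ (k : Fin d) (P : MvPolynomial (V × Fin d) ℝ),
      (∃ i ∈ W, ∃ c' : ℝ, P = X (i, k) + C c') →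
      ∀ j k', degreeOf (j, k') P ≤ if j ∈ W ∧ k' = k then 1 else 0 := by
    rintro k _ ⟨i, hi, c, rfl⟩ j k'
    exact degreeOf_X_add_C_le hi k k' c
  have hbox : FiniteSelection (fun P => ∀ j k, degreeOf (j, k) P ≤ if j ∈ W then 1 else 0)
      (fun y => ∏ k, max (Φ.q H B W k y) 0) := by
    refine FiniteSelection.map
      (R := fun k P => ∀ j k', degreeOf (j, k') P ≤ if j ∈ W ∧ k' = k then 1 else 0)
      (F := fun k y => max (Φ.q H B W k y) 0) (fun k => ?_) (fun p => ∏ k, p k)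
      (fun p hp => degreeOf_prod_coordinates_le hp) fun y p hp => ?_
    · refine .of_cases (F := fun b : Bool => cond b (Φ.q H B W k) 0) (fun b => ?_) fun y => ?_
      · cases b
        · exact .of_poly (P := 0) (by simp) (by simp)
        · exact (finiteSelection_q hW k).mono (hlin k)
      · rcases max_choice (Φ.q H B W k y) 0 with h | h
        · exact ⟨true, h⟩
        · exact ⟨false, h⟩
    · simp only [hp, map_prod]
  have hhole : ∀ c : Fin d → ℤ,
      FiniteSelection (fun P => ∀ j k, degreeOf (j, k) P ≤ if j ∈ W then 1 else 0)
      (fun y => ∏ k, max 0 (min 1 (Φ.minUpper B W k y - (c k : ℝ) + 1))) := by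
    intro c
    refine FiniteSelection.map
      (R := fun k P => ∀ j k', degreeOf (j, k') P ≤ if j ∈ W ∧ k' = k then 1 else 0)
      (F := fun k y => max 0 (min 1 (Φ.minUpper B W k y - (c k : ℝ) + 1))) (fun k => ?_)
      (fun p => ∏ k, p k) (fun p hp => degreeOf_prod_coordinates_le hp) fun y p hp => ?_
    · refine .of_cases (F := fun b : Option Bool => b.elim
        (fun y => Φ.minUpper B W k y + (1 - (c k : ℝ))) fun b => cond b 1 0)
        (fun b => ?_) fun y => ?_
      · rcases b with _ | _ | _
        · exact (finiteSelection_minUpper_add hW k _).mono (hlin k)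
        · exact .of_poly (P := 0) (by simp) (by simp)
        · exact .of_poly (P := 1) (by simp) (by simp)
      · rcases max_choice 0 (min 1 (Φ.minUpper B W k y - (c k : ℝ) + 1)) with h | h
        · exact ⟨some false, h⟩
        · rcases min_choice 1 (Φ.minUpper B W k y - (c k : ℝ) + 1) with h' | h'
          · exact ⟨some true, h.trans h'⟩
          · refine ⟨none, h.trans (h'.trans ?_)⟩
            simp only [Option.elim]
            ring
    · simp only [hp, map_prod]
  have hholes : FiniteSelection (fun P => ∀ j k, degreeOf (j, k) P ≤ if j ∈ W then 1 else 0)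
      (fun y => ∑ᶠ c ∈ Φ.switchedHoles H B W,
        ∏ k, max 0 (min 1 (Φ.minUpper B W k y - (c k : ℝ) + 1))) := by
    refine FiniteSelection.map (κ := hS.toFinset) (fun c => hhole c) (fun p => ∑ c, p c)
      (fun p hp j k => ?_) fun y p hp => ?_
    · exact (degreeOf_sum_le _ _ _).trans (Finset.sup_le fun c _ => hp c j k)
    · rw [finsum_mem_eq_finite_toFinset_sum _ hS, ← Finset.sum_coe_sort, map_sum]
      exact Finset.sum_congr rfl fun c _ => hp c
  exact hbox.map₂ hholes (fun p q => p - q)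
    (fun p q hp hq j k => (degreeOf_sub_le _ _ _).trans (max_le (hp j k) (hq j k)))
    fun y p q hp hq => by rw [map_sub, ← hp, ← hq]; rfl

theorem finiteSelection_realChromatic [Fintype E] (hd : 0 < d)
    (hH : ∀ i, IsConeMinusFinite (H i)) :
    FiniteSelection (fun P => ∀ i, P.degreeOf i ≤ 1) (Φ.realChromatic H) := by
  classical
  refine FiniteSelection.map (κ := Φ.Latb) (R := fun B P => ∀ i, degreeOf i P ≤ 1)
    (F := fun B y => ∏ W ∈ Φ.parts B.1, Φ.truncatedCount H B.1 W y) (fun B => ?_)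
    (fun p => ∑ B, C (Φ.muEmpty B : ℝ) * p B) (fun p hp i => ?_) fun y p hp => ?_
  · refine FiniteSelection.map (κ := Φ.parts B.1)
      (fun W => finiteSelection_truncatedCount (Φ := Φ) (B := B.1) hd hH
        (nonempty_of_mem_parts W.2))
      (fun p => ∏ W, p W) (fun p hp => degreeOf_prod_parts_le hp) fun y p hp => ?_
    rw [← Finset.prod_coe_sort, map_prod]
    exact Finset.prod_congr rfl fun W _ => hp W
  · exact (degreeOf_sum_le _ _ _).trans
      (Finset.sup_le fun B _ => (degreeOf_C_mul_le _ _ _).trans (hp B i))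
  · simp only [realChromatic, map_sum, map_mul, eval_C, hp]

open Classical in
-- Without truncation every q_k selects some X(r k, k) plus a constant, so all selected polynomials
-- have degree d; the hole count is a constant, of degree 0 < d.
theorem finiteSelection_component (hd : 0 < d) (hW : W.Nonempty) :
    FiniteSelection (fun P => (∀ j k, degreeOf (j, k) P ≤ if j ∈ W then 1 else 0) ∧
        ∃ r : Fin d → V, (∀ k, r k ∈ W) ∧ HasLeadingForm (∏ k, X (r k, k)) d P)
      (fun y => (∏ k, Φ.q H B W k y) - ((Φ.switchedHoles H B W).ncard : ℝ)) := by
  refine FiniteSelection.map (fun k => finiteSelection_q (Φ := Φ) (H := H) (B := B) hW k)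
    (fun p => ∏ k, p k + C (-((Φ.switchedHoles H B W).ncard : ℝ))) (fun p hp => ?_)
    fun y p hp => ?_
  · choose r hr c hc using hp
    obtain rfl : p = fun k => X (r k, k) + C (c k) := funext hc
    refine ⟨fun j k => (degreeOf_add_le _ _ _).trans
      (max_le ?_ ((degreeOf_C _ _).trans_le (Nat.zero_le _))), r, hr, ?_⟩
    · exact degreeOf_prod_coordinates_le (fun k j k' => degreeOf_X_add_C_le (hr k) k k' (c k)) j k
    · refine HasLeadingForm.add ?_ ((DegreeLT.C _).mono hd)
      simpa using HasLeadingForm.prod (s := Finset.univ) (m := fun _ => 1)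
        fun k _ => HasLeadingForm.X_add_C (r k, k) (c k)
  · simp only [map_add, map_prod, eval_C, hp]
    ring

theorem finiteSelection_parts (hd : 0 < d) :
    FiniteSelection (fun P => (∀ i, degreeOf i P ≤ 1) ∧
        ∃ r : Φ.parts B → Fin d → V, (∀ W k, r W k ∈ W.1) ∧
          HasLeadingForm (∏ W, ∏ k, X (r W k, k)) ((Φ.parts B).card * d) P)
      (fun y => ∏ W ∈ Φ.parts B,
        ((∏ k, Φ.q H B W k y) - ((Φ.switchedHoles H B W).ncard : ℝ))) := by
  classical
  refine FiniteSelection.map (κ := Φ.parts B)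
    (fun W => finiteSelection_component (Φ := Φ) (H := H) (B := B) hd
      (nonempty_of_mem_parts W.2)) (fun p => ∏ W, p W)
    (fun p hp => ⟨degreeOf_prod_parts_le fun W => (hp W).1, ?_⟩) fun y p hp => ?_
  · choose r hr hl using fun W => (hp W).2
    exact ⟨r, hr, by simpa using HasLeadingForm.prod (s := Finset.univ) fun W _ => hl W⟩
  · rw [← Finset.prod_coe_sort, map_prod]
    exact Finset.prod_congr rfl fun W _ => hp W

theorem component_empty (u : V) : Φ.component ∅ u = {u} := by
  ext v
  rw [mem_component, Finset.mem_singleton]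
  constructor
  · rintro ⟨l, g, h⟩
    cases h with
    | nil => rfl
    | cons he => simp at he
  · rintro rfl
    exact ⟨[], 0, Walk.nil v⟩

theorem card_parts_empty : (Φ.parts ∅).card = Fintype.card V := by
  classical
  rw [parts, Finset.card_image_of_injective, Finset.card_univ]
  intro u v h
  simpa [component_empty] using h

theorem prod_parts_empty {M : Type*} [CommMonoid M] (F : V → M) {r : Φ.parts ∅ → V}
    (hr : ∀ W, r W ∈ W.1) : ∏ W, F (r W) = ∏ i, F i := by
  classical
  symm
  refine Fintype.prod_bijective (fun i => ⟨Φ.component ∅ i, component_mem_parts i⟩) ?_ _ _ ?_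
  · constructor
    · intro u v h
      simpa [component_empty] using h
    · intro W
      exact ⟨r W, Subtype.ext (eq_component W.2 (hr W)).symm⟩
  · intro i
    have := hr ⟨Φ.component ∅ i, component_mem_parts i⟩
    simp only [component_empty, Finset.mem_singleton] at this
    simp only [component_empty, this]

/-- An edge of B cannot be a loop, since its gain would be 0 by balance; hence it joins two distinct
vertices in one component. -/
theorem card_parts_lt (hloop : ∀ e v, ¬ Φ.Step e v v 0)
    (hloose : ∀ e, Φ.edge e ≠ GainEdge.loose) (hB : Φ.Balanced B) (hne : B ≠ ∅) :
    (Φ.parts B).card < Fintype.card V := by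
  classical
  obtain ⟨e, he⟩ := Finset.nonempty_iff_ne_empty.2 hne
  obtain ⟨u, v, g, hs⟩ : ∃ u v g, Φ.Step e u v g := by
    cases hedge : Φ.edge e with
    | arc u v g => exact ⟨u, v, g, Or.inl hedge⟩
    | half v => exact absurd hedge (hB.1 e he v)
    | loose => exact absurd hedge (hloose e)
  have hw := Walk.cons he hs (Walk.nil v)
  have huv : u ≠ v := by
    rintro rfl
    have := hB.closed_walk hw
    rw [add_zero] at this
    subst this
    exact hloop e u hs
  refine lt_of_le_of_ne Finset.card_image_le fun h => huv ?_
  have hinj := Finset.card_image_iff.1 h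
  exact hinj (Finset.mem_coe.2 (Finset.mem_univ u)) (Finset.mem_coe.2 (Finset.mem_univ v))
    (component_eq_of_mem (mem_component.2 ⟨_, _, hw⟩)).symm

/-- For B = ∅ the minimum is over one vertex, which forces the product of all variables, with
coefficient μ(∅, ∅) = 1. Every other B contributes lower total degree, so every selected polynomial
has the leading term. -/
theorem finiteSelection_p [Fintype E] (hd : 0 < d) (hloop : ∀ e v, ¬ Φ.Step e v v 0)
    (hloose : ∀ e, Φ.edge e ≠ GainEdge.loose) :
    FiniteSelection (fun P => IsMonicMultilinear P ∧ ∀ i, P.degreeOf i ≤ 1) (Φ.p H) := by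
  classical
  refine FiniteSelection.map
    (fun B : Φ.Latb => finiteSelection_parts (Φ := Φ) (B := B.1) (H := H) hd)
    (fun p => ∑ B, C (Φ.muEmpty B : ℝ) * p B) (fun p hp => ⟨?_, fun i => ?_⟩) fun y p hp => ?_
  · have h₀ := empty_mem_latb hloop hloose
    have hcard : Fintype.card (V × Fin d) = Fintype.card V * d := by simp
    suffices DegreeLT (Fintype.card V * d)
        (∑ B, C (Φ.muEmpty B : ℝ) * p B - ∏ i : V × Fin d, X i) by
      intro s hs
      rw [hcard]
      exact this s hs
    rw [← Finset.add_sum_erase _ _ (Finset.mem_univ (⟨∅, h₀⟩ : Φ.Latb)), muEmpty_empty,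
      Int.cast_one, C_1, one_mul, add_sub_right_comm]
    refine DegreeLT.add ?_ (DegreeLT.sum fun B hB => DegreeLT.C_mul _ ?_)
    · obtain ⟨r, hr, -, hl⟩ := (hp ⟨∅, h₀⟩).2
      rw [card_parts_empty] at hl
      rw [Fintype.prod_prod_type, Finset.prod_comm]
      rw [Finset.prod_comm] at hl
      have : ∀ k, ∏ W, (X (r W k, k) : MvPolynomial (V × Fin d) ℝ) = ∏ i, X (i, k) := fun k =>
        prod_parts_empty (fun i => (X (i, k) : MvPolynomial (V × Fin d) ℝ)) fun W => hr W k
      simpa only [this] using hl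
    · obtain ⟨r, hr, hl⟩ := (hp B).2
      have hne : B.1 ≠ ∅ := fun h => (Finset.mem_erase.1 hB).1 (Subtype.ext h)
      refine hl.degreeLT.mono ?_
      exact Nat.mul_lt_mul_of_pos_right (card_parts_lt hloop hloose B.2.1 hne) hd
  · exact (degreeOf_sum_le _ _ _).trans
      (Finset.sup_le fun B _ => (degreeOf_C_mul_le _ _ _).trans ((hp B).1 i))
  · simp only [GainGraph.p, map_sum, map_mul, eval_C, hp]

end Selections

end GainGraph

/-! ### Assembly of the theorem -/

theorem theoremT {V E : Type*} [Fintype V] [Fintype E] {d : ℕ} (hd : 0 < d)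
    (Φ : GainGraph V E (Fin d → ℤ)) (H : V → Set (Fin d → ℤ))
    (hloop : ∀ e v, ¬ Φ.Step e v v 0)
    (hloose : ∀ e, Φ.edge e ≠ GainEdge.loose)
    (hH : ∀ i, IsConeMinusFinite (H i)) :
    -- the number of proper colorations is finite for every upper bound
    (∀ m : V → Fin d → ℤ, (Φ.properColorations H m).Finite) ∧
    -- `p` is a piecewise polynomial with leading term the product of all variables
    IsPiecewisePolynomialWithLeadingProd (Φ.p H) ∧
    -- so is the list chromatic function, as the restriction to the integer points of a function
    -- that equals `p` as soon as all variables reach the bound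
    (∃ f : (V × Fin d → ℝ) → ℝ,
      IsPiecewisePolynomialWithLeadingProd f ∧
      (∀ m : V → Fin d → ℤ, (Φ.listChromatic H m : ℝ) = f (fun ik => (m ik.1 ik.2 : ℝ))) ∧
      ∀ y : V × Fin d → ℝ, (∀ i k, (Φ.bound H i k : ℝ) ≤ y (i, k)) → f y = Φ.p H y) ∧
    -- the list chromatic function equals `p` from the bound on
    (∀ m : V → Fin d → ℤ, (∀ i, Φ.bound H i ≤ m i) →
      (Φ.listChromatic H m : ℝ) = Φ.p H (fun ik => (m ik.1 ik.2 : ℝ))) := by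
  have hp := GainGraph.finiteSelection_p (H := H) hd hloop hloose
  have hχ := Φ.listChromatic_eq_realChromatic hd hloop hloose hH
  refine ⟨fun m => (GainGraph.finite_list_le hH m).subset fun x hx => hx.1, ?_,
    ⟨Φ.realChromatic H, ?_, hχ, fun y hy => GainGraph.realChromatic_eq_p hd hH hy⟩, ?_⟩
  · exact isPiecewisePolynomialWithLeadingProd_of_finiteSelection GainGraph.continuous_p
      (hp.mono fun _ hP => hP.2) hp isOpen_univ Set.univ_nonempty fun _ _ => rfl
  · refine isPiecewisePolynomialWithLeadingProd_of_finiteSelection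
      (GainGraph.continuous_realChromatic hd hH) (GainGraph.finiteSelection_realChromatic hd hH) hp
      -- Strict inequalities give the open set required for the leading term.
      (U := {y | ∀ i k, (Φ.bound H i k : ℝ) < y (i, k)}) ?_
      ⟨fun ik => Φ.bound H ik.1 ik.2 + 1, fun i k => lt_add_one _⟩
      fun y hy => GainGraph.realChromatic_eq_p hd hH fun i k => (hy i k).le
    simp only [Set.ofPred_forall]
    exact isOpen_iInter_of_finite fun i => isOpen_iInter_of_finite fun k =>
      isOpen_lt continuous_const (continuous_apply _)
  · intro m hm
    rw [hχ]
    exact GainGraph.realChromatic_eq_p hd hH fun i k => Int.cast_le.2 (hm i k)
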